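/- Let $SG(0)$ be a triangle with leftmost, rightmost and topmost vertices $o,a_0,b_0$, and let $SG(n+1)$ be the juxtaposition of three copies of $SG(n)$ (lower left, lower right, top), each pair sharing one corner; the lower-left copy is identified with $SG(n)$, so $SG(0)\subset SG(1)\subset\cdots$ all share the leftmost vertex $o$. Let $a_m,b_m$ be the rightmost and topmost vertices of $SG(m)$, and $c_m$ the midpoint of the side $a_{m+1}b_{m+1}$ of $SG(m+1)$. For $m\ge1$ let $a_{m,1},b_{m,1},c_{m,1}$ be the midpoints of the segments $a_ma_{m+1}$, $a_mc_m$, $a_{m+1}c_m$ respectively. For a vertex $x$ let $\tilde x$ be its reflection in the line through $o$ and $c_0$, and for a vertex $x$ of $SG(n)$, $n\ge1$, let $\hat x$ be its reflection in the line through $a_n$ and $b_{n-1}$. For a vertex $x$ of $SG(n)$ let $F_j(n,x)$ be the number of spanning trees of $SG(n)$ with exactly $j$ edges at $x$ divided by the number of all spanning trees. Let $G_j(n,x)$ be the analogous proportion among the spanning forests of $SG(n)$ with exactly two trees, one containing $b_n$ and the other containing both $o$ and $a_n$, and let $H_j(n,x)$ be the analogous proportion among the spanning forests with exactly three trees such that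 $o,a_n,b_n$ lie in different trees (single-vertex trees are allowed). For $n\ge2$ let $B_j(n-1,n-2)$ be the $3\times5$ matrix whose rows, for $x=a_{n-2},\,b_{n-2},\,c_{n-2}$ in this order, are \[ \bigl(F_j(n-1,x),\ G_j(n-1,x),\ G_j(n-1,\tilde x),\ G_j(n-1,\hat x),\ H_j(n-1,x)\bigr), \] where $\hat x$ is taken in $SG(n-1)$. Put $e_1=(1,0,0,0,0)^T$, \[ R=\begin{pmatrix} \frac23&\frac35&\frac1{10}&\frac35&\frac6{25}\\ \frac16&\frac3{10}&\frac1{10}&\frac1{10}&\frac7{50}\\ 0&0&\frac25&0&\frac6{25}\\ \frac16&\frac1{10}&\frac1{10}&\frac3{10}&\frac7{50}\\ 0&0&\frac3{10}&0&\frac6{25} \end{pmatrix},\qquad L=\begin{pmatrix} \frac23&\frac35&\frac35&\frac35&\frac6{25}\\ \frac16&\frac3{10}&\frac1{10}&0&\frac7{50}\\ \frac16&\frac1{10}&\frac3{10}&\frac1{10}&\frac7{50}\\ 0&0&0&\frac3{10}&\frac6{25}\\ 0&0&0&0&\frac6{25} \end{pmatrix}. \] Then for all $n\ge2$, $m\ge0$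 and $j\in\{1,2,3,4\}$, \[ \begin{pmatrix}F_j(n+m,a_{n-1,1})\\F_j(n+m,b_{n-1,1})\\F_j(n+m,c_{n-1,1})\end{pmatrix} =\begin{pmatrix}F_j(n+m,\tilde a_{n-1,1})\\F_j(n+m,\tilde b_{n-1,1})\\F_j(n+m,\tilde c_{n-1,1})\end{pmatrix} =B_j(n-1,n-2)\,R\,L^m e_1 . \] -/

import Mathlib

namespace SG

open Classical in
/-- Vertices of the stage-`n` gasket `SG(n)`, in the lattice coordinates in which `(i, j)` is the
point `i • u + j • v`, where `u`, `v` are unit vectors from the leftmost vertex `o = (0, 0)`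
along the horizontal side and along the left side.  Stage `n + 1` is the juxtaposition
of three copies of stage `n`. -/
noncomputable def verts : ℕ → Finset (ℕ × ℕ)
  | 0 => {(0, 0), (1, 0), (0, 1)}
  | n + 1 => verts n ∪ (verts n).image (fun p => (p.1 + 2 ^ n, p.2))
      ∪ (verts n).image (fun p => (p.1, p.2 + 2 ^ n))

open Classical in
/-- Edges (bonds) of `SG(n)`. -/
noncomputable def edges : ℕ → Finset (Sym2 (ℕ × ℕ))
  | 0 => {s((0, 0), (1, 0)), s((0, 0), (0, 1)), s((1, 0), (0, 1))}
  | n + 1 => edges n ∪ (edges n).image (Sym2.map fun p => (p.1 + 2 ^ n, p.2))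
      ∪ (edges n).image (Sym2.map fun p => (p.1, p.2 + 2 ^ n))

/-- The leftmost vertex `o`. -/
def o : ℕ × ℕ := (0, 0)

/-- `a_m`, the rightmost vertex of `SG(m)`. -/
def a (m : ℕ) : ℕ × ℕ := (2 ^ m, 0)

/-- `b_m`, the topmost vertex of `SG(m)`. -/
def b (m : ℕ) : ℕ × ℕ := (0, 2 ^ m)

/-- `c_m`: the vertices `a_m`, `b_m`, `c_m` demarcate the largest lacunary triangle
of `SG(m + 1)`. -/
def c (m : ℕ) : ℕ × ℕ := (2 ^ m, 2 ^ m)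

theorem o_mem (n : ℕ) : o ∈ verts n := by
  induction n with
  | zero => simp [verts, o]
  | succ n ih => simp only [verts, Finset.mem_union]; exact Or.inl (Or.inl ih)

theorem a_mem (n : ℕ) : a n ∈ verts n := by
  induction n with
  | zero => simp [verts, a]
  | succ n ih =>
    simp only [verts, Finset.mem_union, Finset.mem_image]
    exact Or.inl (Or.inr ⟨a n, ih, by simp [a, pow_succ, mul_two]⟩)

theorem b_mem (n : ℕ) : b n ∈ verts n := by
  induction n with
  | zero => simp [verts, b]
  | succ n ih =>
    simp only [verts, Finset.mem_union, Finset.mem_image]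
    exact Or.inr ⟨b n, ih, by simp [b, pow_succ, mul_two]⟩

/-- The spanning subgraph of `SG(n)` with edge set `S` (used for `S ⊆ edges n`): its vertex set
is all of `verts n`. -/
def spanSub (n : ℕ) (S : Finset (Sym2 (ℕ × ℕ))) : SimpleGraph (verts n) :=
  (SimpleGraph.fromEdgeSet (S : Set (Sym2 (ℕ × ℕ)))).induce (verts n : Set (ℕ × ℕ))

open Classical in
/-- The number of bonds of `S` connected to the vertex `x`. -/
noncomputable def bonds (S : Finset (Sym2 (ℕ × ℕ))) (x : ℕ × ℕ) : ℕ :=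
  (S.filter fun e => x ∈ e).card

/-- The vertex `o`, as an element of the vertex set of `SG(n)`. -/
def oV (n : ℕ) : verts n := ⟨o, o_mem n⟩

/-- The vertex `a_n`, as an element of the vertex set of `SG(n)`. -/
def aV (n : ℕ) : verts n := ⟨a n, a_mem n⟩

/-- The vertex `b_n`, as an element of the vertex set of `SG(n)`. -/
def bV (n : ℕ) : verts n := ⟨b n, b_mem n⟩

open Classical in
/-- Spanning trees of `SG(n)`. -/
noncomputable def trees (n : ℕ) : Finset (Finset (Sym2 (ℕ × ℕ))) :=
  (edges n).powerset.filter fun S => (spanSub n S).IsTree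

open Classical in
/-- Spanning subgraphs of `SG(n)` with two trees such that `b_n` belongs to one tree and
`o`, `a_n` belong to the other. -/
noncomputable def forests₂ (n : ℕ) : Finset (Finset (Sym2 (ℕ × ℕ))) :=
  (edges n).powerset.filter fun S =>
    (spanSub n S).IsAcyclic ∧ Nat.card (spanSub n S).ConnectedComponent = 2 ∧
      (spanSub n S).Reachable (oV n) (aV n) ∧ ¬ (spanSub n S).Reachable (oV n) (bV n)

open Classical in
/-- Spanning subgraphs of `SG(n)` with three trees such that `o`, `a_n`, `b_n` belong to
different trees. -/
noncomputable def forests₃ (n : ℕ) : Finset (Finset (Sym2 (ℕ × ℕ))) :=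
  (edges n).powerset.filter fun S =>
    (spanSub n S).IsAcyclic ∧ Nat.card (spanSub n S).ConnectedComponent = 3 ∧
      ¬ (spanSub n S).Reachable (oV n) (aV n) ∧ ¬ (spanSub n S).Reachable (oV n) (bV n) ∧
      ¬ (spanSub n S).Reachable (aV n) (bV n)

/-- `F_j(n, x)`: the fraction of spanning trees of `SG(n)` with `j` bonds at `x`. -/
noncomputable def F (j n : ℕ) (x : ℕ × ℕ) : ℚ :=
  (((trees n).filter fun S => bonds S x = j).card : ℚ) / ((trees n).card : ℚ)

/-- `G_j(n, x)`: the same for the two-tree spanning subgraphs. -/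
noncomputable def G (j n : ℕ) (x : ℕ × ℕ) : ℚ :=
  (((forests₂ n).filter fun S => bonds S x = j).card : ℚ) / ((forests₂ n).card : ℚ)

/-- `H_j(n, x)`: the same for the three-tree spanning subgraphs. -/
noncomputable def H (j n : ℕ) (x : ℕ × ℕ) : ℚ :=
  (((forests₃ n).filter fun S => bonds S x = j).card : ℚ) / ((forests₃ n).card : ℚ)

/-- `x̃`: reflection with respect to the line through `o` and `c_0`. -/
def tilde (x : ℕ × ℕ) : ℕ × ℕ := (x.2, x.1)

/-- `x̂` in `SG(n)`: reflection with respect to the line through `a_n` and the midpoint `b_{n-1}`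
of `o` and `b_n`; it fixes `a_n` and exchanges `o` and `b_n`.  On `SG(n)` one has
`x.1 + x.2 ≤ 2 ^ n`, so the subtraction is not truncated. -/
def hat (n : ℕ) (x : ℕ × ℕ) : ℕ × ℕ := (x.1, 2 ^ n - x.1 - x.2)

/-- The vertices `a_m`, `b_m`, `c_m`. -/
def vtx (m : ℕ) : Fin 3 → ℕ × ℕ := ![a m, b m, c m]

/-- For `m ≥ 1` the vertices `a_{m,1}`, `b_{m,1}`, `c_{m,1}`, which demarcate the largest lacunary
triangle inside the triangle with outmost vertices `a_m`, `a_{m+1}`, `c_m`: the midpoints of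
`a_m a_{m+1}`, of `a_m c_m`, and of `a_{m+1} c_m`. -/
def vtxOne (m : ℕ) : Fin 3 → ℕ × ℕ :=
  ![(2 ^ m + 2 ^ (m - 1), 0), (2 ^ m, 2 ^ (m - 1)), (2 ^ m + 2 ^ (m - 1), 2 ^ (m - 1))]

/-- The matrix `B_j(N, γ)` for a subscript `γ` whose three vertices `a_γ, b_γ, c_γ` are `v 0, v 1, v 2`
and lie in `SG(n)`, `n ≤ N`; the reflection `x̂` is the one of `SG(n)`. -/
noncomputable def B (j N n : ℕ) (v : Fin 3 → ℕ × ℕ) : Matrix (Fin 3) (Fin 5) ℚ :=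
  Matrix.of fun i =>
    ![F j N (v i), G j N (v i), G j N (tilde (v i)), G j N (hat n (v i)), H j N (v i)]

/-- The matrix `L`. -/
def L : Matrix (Fin 5) (Fin 5) ℚ :=
  !![2/3, 3/5,  3/5,  3/5,  6/25;
     1/6, 3/10, 1/10, 0,    7/50;
     1/6, 1/10, 3/10, 1/10, 7/50;
     0,   0,    0,    3/10, 6/25;
     0,   0,    0,    0,    6/25]

/-- The matrix `R`. -/
def R : Matrix (Fin 5) (Fin 5) ℚ :=
  !![2/3, 3/5,  1/10, 3/5,  6/25;
     1/6, 3/10, 1/10, 1/10, 7/50;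
     0,   0,    2/5,  0,    6/25;
     1/6, 1/10, 1/10, 3/10, 7/50;
     0,   0,    3/10, 0,    6/25]

/-- The vector `(1,0,0,0,0)ᵀ`. -/
def e₁ : Fin 5 → ℚ := ![1, 0, 0, 0, 0]

end SG

/-!
A spanning forest of `SG(n)` in which every tree contains a corner is classified by which corners
are connected: five patterns. Cutting `SG(n + 1)` into its three copies of `SG(n)` identifies the
forests of a given pattern with triples of forests of the copies whose patterns are compatible: the
connections across the copies may neither close a cycle around the central hole nor leave a junction
unattached. By induction the numbers of forests with the five patterns are `f`, three times `f * r`,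
and `3 * f * r ^ 2`, so that within one pattern of `SG(n + 1)` the pattern of a single copy has
a distribution that does not depend on `n`; it is a column of `R` for the lower right copy and
of `L` for the lower left one. The reflections of the gasket turn the columns of `B` into the
proportions for the five patterns.
-/

namespace SG

open SimpleGraph (fromEdgeSet)

/-! ## Gluing graphs around a triangular hole -/

section TwoPieces

variable {V : Type*} {G H : SimpleGraph V} {U W : Set V} {p q u w : V}

theorem cases_of_reachable_sup (hG : G.support ⊆ U) (hH : H.support ⊆ W)
    (hUW : U ∩ W ⊆ {p, q}) (hu : u ∈ U) (h : (G ⊔ H).Reachable u w) :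
    (w ∈ U → G.Reachable u w ∨
      H.Reachable p q ∧ (G.Reachable u p ∧ G.Reachable q w ∨ G.Reachable u q ∧ G.Reachable p w)) ∧
    (w ∈ W → G.Reachable u p ∧ H.Reachable p w ∨ G.Reachable u q ∧ H.Reachable q w) := by
  have cross_iff_same (x : V) (hxU : x ∈ U) (hxW : x ∈ W) :
      (G.Reachable u x ∨ H.Reachable p q ∧
        (G.Reachable u p ∧ G.Reachable q x ∨ G.Reachable u q ∧ G.Reachable p x)) ↔
      (G.Reachable u p ∧ H.Reachable p x ∨ G.Reachable u q ∧ H.Reachable q x) := by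
    have refl_G (y : V) : G.Reachable y y := .refl y
    have refl_H (y : V) : H.Reachable y y := .refl y
    have comm := H.reachable_comm (u := p) (v := q)
    have trans_p (h : G.Reachable u p) (h' : G.Reachable p q) := h.trans h'
    have trans_q (h : G.Reachable u q) (h' : G.Reachable q p) := h.trans h'
    rcases hUW ⟨hxU, hxW⟩ with rfl | rfl <;> grind only
  induction (SimpleGraph.reachable_iff_reflTransGen _ _).1 h with
  | refl =>
    exact ⟨fun _ => .inl (.refl u), fun huW => (cross_iff_same u hu huW).1 (.inl (.refl u))⟩
  | @tail x y hx hxy ih =>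
    replace ih := ih ((SimpleGraph.reachable_iff_reflTransGen _ _).2 hx)
    rcases hxy with hxy | hxy
    · have hyU : y ∈ U := hG ⟨x, hxy.symm⟩
      have extend {z : V} (h : G.Reachable z x) : G.Reachable z y := h.trans hxy.reachable
      have same_y := (ih.1 (hG ⟨y, hxy⟩)).imp extend
        (And.imp_right (Or.imp (And.imp_right extend) (And.imp_right extend)))
      exact ⟨fun _ => same_y, fun hyW => (cross_iff_same y hyU hyW).1 same_y⟩
    · have hyW : y ∈ W := hH ⟨x, hxy.symm⟩
      have extend {z : V} (h : H.Reachable z x) : H.Reachable z y := h.trans hxy.reachable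
      have cross_y := (ih.2 (hH ⟨y, hxy⟩)).imp (And.imp_right extend) (And.imp_right extend)
      exact ⟨fun hyU => (cross_iff_same y hyU hyW).2 cross_y, fun _ => cross_y⟩

theorem reachable_sup_iff_of_mem_left (hG : G.support ⊆ U) (hH : H.support ⊆ W)
    (hUW : U ∩ W ⊆ {p, q}) (hu : u ∈ U) (hw : w ∈ U) :
    (G ⊔ H).Reachable u w ↔ G.Reachable u w ∨ H.Reachable p q ∧
      (G.Reachable u p ∧ G.Reachable q w ∨ G.Reachable u q ∧ G.Reachable p w) := by
  refine ⟨fun h => (cases_of_reachable_sup hG hH hUW hu h).1 hw, ?_⟩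
  have left {x y : V} (h : G.Reachable x y) : (G ⊔ H).Reachable x y := h.mono le_sup_left
  have right {x y : V} (h : H.Reachable x y) : (G ⊔ H).Reachable x y := h.mono le_sup_right
  rintro (h | ⟨hpq, ⟨hup, hqw⟩ | ⟨huq, hpw⟩⟩)
  · exact left h
  · exact ((left hup).trans (right hpq)).trans (left hqw)
  · exact ((left huq).trans (right hpq.symm)).trans (left hpw)

theorem reachable_sup_iff_of_mem_of_mem (hG : G.support ⊆ U) (hH : H.support ⊆ W)
    (hUW : U ∩ W ⊆ {p, q}) (hu : u ∈ U) (hw : w ∈ W) :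
    (G ⊔ H).Reachable u w ↔
      G.Reachable u p ∧ H.Reachable p w ∨ G.Reachable u q ∧ H.Reachable q w := by
  refine ⟨fun h => (cases_of_reachable_sup hG hH hUW hu h).2 hw, ?_⟩
  rintro (⟨h, h'⟩ | ⟨h, h'⟩) <;> exact (h.mono le_sup_left).trans (h'.mono le_sup_right)

theorem reachable_sup_iff_of_inter_subset_singleton (hG : G.support ⊆ U) (hH : H.support ⊆ W)
    (hUW : U ∩ W ⊆ {p}) (hu : u ∈ U) (hw : w ∈ U) :
    (G ⊔ H).Reachable u w ↔ G.Reachable u w := by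
  rw [reachable_sup_iff_of_mem_left hG hH (hUW.trans_eq (Set.pair_eq_singleton p).symm) hu hw,
    or_self]
  exact or_iff_left_of_imp fun h => h.2.1.trans h.2.2

theorem disjoint_of_support_subset (hG : G.support ⊆ U) (hH : H.support ⊆ W)
    (hUW : U ∩ W ⊆ {p}) : Disjoint G H := by
  refine SimpleGraph.disjoint_left.2 fun x y hxy hxy' => hxy.ne ?_
  exact (hUW ⟨hG ⟨y, hxy⟩, hH ⟨y, hxy'⟩⟩).trans (hUW ⟨hG ⟨x, hxy.symm⟩, hH ⟨x, hxy'.symm⟩⟩).symm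

theorem isBridge_sup_of_isAcyclic (hG : G.support ⊆ U) (hH : H.support ⊆ W)
    (hUW : U ∩ W ⊆ {p, q}) (hGH : Disjoint G H) (hGa : G.IsAcyclic)
    (hpq : G.Reachable p q → H.Reachable p q → p = q) (huw : G.Adj u w) :
    (G ⊔ H).IsBridge s(u, w) := by
  have bridge := SimpleGraph.isAcyclic_iff_forall_adj_isBridge.1 hGa huw
  have not_adj : s(u, w) ∉ H.edgeSet := fun h =>
    (SimpleGraph.disjoint_edgeSet.2 hGH).le_bot ⟨huw, h⟩
  set G' := G.deleteEdges {s(u, w)} with hG'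
  have le : G' ≤ G := SimpleGraph.deleteEdges_le _
  rw [SimpleGraph.isBridge_iff, SimpleGraph.deleteEdges_sup,
    SimpleGraph.deleteEdges_eq_self (G := H).2 (Set.disjoint_singleton_right.2 not_adj), ← hG',
    reachable_sup_iff_of_mem_left ((SimpleGraph.support_mono le).trans hG) hH hUW (hG ⟨w, huw⟩)
      (hG ⟨u, huw.symm⟩)]
  rintro (h | ⟨hH', ⟨hup, hqw⟩ | ⟨huq, hpw⟩⟩)
  · exact bridge h
  · obtain rfl := hpq (((hup.mono le).symm.trans huw.reachable).trans (hqw.mono le).symm) hH'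
    exact bridge (hup.trans hqw)
  · obtain rfl := hpq ((hpw.mono le).trans (huw.symm.reachable.trans (huq.mono le))) hH'
    exact bridge (huq.trans hpw)

theorem eq_of_reachable_of_isAcyclic_sup (hGH : Disjoint G H) (h : (G ⊔ H).IsAcyclic)
    (hG : G.Reachable p q) (hH : H.Reachable p q) : p = q := by
  obtain ⟨P, hP⟩ := hG.exists_isPath
  obtain ⟨Q, hQ⟩ := hH.exists_isPath
  have paths_eq := congrArg Subtype.val ((h.subsingleton_path p q).elim
    ⟨P.mapLe le_sup_left, hP.mapLe le_sup_left⟩ ⟨Q.mapLe le_sup_right, hQ.mapLe le_sup_right⟩)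
  have edges_eq : P.edges = Q.edges := by
    simpa using congrArg SimpleGraph.Walk.edges paths_eq
  cases P with
  | nil => rfl
  | @cons _ r _ hpr P =>
    have : s(p, r) ∈ Q.edges := by simp [← edges_eq]
    exact ((SimpleGraph.disjoint_edgeSet.2 hGH).le_bot ⟨hpr, Q.edges_subset_edgeSet this⟩).elim

theorem isAcyclic_sup_iff (hG : G.support ⊆ U) (hH : H.support ⊆ W) (hUW : U ∩ W ⊆ {p, q})
    (hGH : Disjoint G H) : (G ⊔ H).IsAcyclic ↔
      G.IsAcyclic ∧ H.IsAcyclic ∧ (G.Reachable p q → H.Reachable p q → p = q) := by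
  refine ⟨fun h => ⟨h.anti le_sup_left, h.anti le_sup_right,
    eq_of_reachable_of_isAcyclic_sup hGH h⟩, fun ⟨hGa, hHa, hpq⟩ => ?_⟩
  refine SimpleGraph.isAcyclic_iff_forall_adj_isBridge.2 fun u w huw => ?_
  rcases huw with huw | huw
  · exact isBridge_sup_of_isAcyclic hG hH hUW hGH hGa hpq huw
  · rw [sup_comm]
    exact isBridge_sup_of_isAcyclic hH hG (Set.inter_comm U W ▸ hUW) hGH.symm hHa
      (fun h h' => hpq h' h) huw

end TwoPieces

/-- `K` is the union of three graphs placed around a triangular hole: any two of the pieces `Gᵢ`,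
living on the vertex sets `Vᵢ`, meet in a single junction `xᵢⱼ`, and no vertex lies in all three. -/
structure IsTriangleGluing {V : Type*} (K G₁ G₂ G₃ : SimpleGraph V) (V₁ V₂ V₃ : Set V)
    (x₁₂ x₂₃ x₃₁ : V) : Prop where
  eq_sup : K = G₁ ⊔ G₂ ⊔ G₃
  support₁ : G₁.support ⊆ V₁
  support₂ : G₂.support ⊆ V₂
  support₃ : G₃.support ⊆ V₃
  inter₁₂ : V₁ ∩ V₂ = {x₁₂}
  inter₂₃ : V₂ ∩ V₃ = {x₂₃}
  inter₃₁ : V₃ ∩ V₁ = {x₃₁}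
  inter₁₂₃ : V₁ ∩ V₂ ∩ V₃ = ∅

namespace IsTriangleGluing

variable {V : Type*} {K G₁ G₂ G₃ : SimpleGraph V} {V₁ V₂ V₃ : Set V} {x₁₂ x₂₃ x₃₁ u w : V}

theorem rotate (h : IsTriangleGluing K G₁ G₂ G₃ V₁ V₂ V₃ x₁₂ x₂₃ x₃₁) :
    IsTriangleGluing K G₂ G₃ G₁ V₂ V₃ V₁ x₂₃ x₃₁ x₁₂ where
  eq_sup := by rw [h.eq_sup, sup_assoc, sup_comm]
  support₁ := h.support₂
  support₂ := h.support₃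
  support₃ := h.support₁
  inter₁₂ := h.inter₂₃
  inter₂₃ := h.inter₃₁
  inter₃₁ := h.inter₁₂
  inter₁₂₃ := by rw [Set.inter_comm, ← Set.inter_assoc, h.inter₁₂₃]

theorem mem₁₂ (h : IsTriangleGluing K G₁ G₂ G₃ V₁ V₂ V₃ x₁₂ x₂₃ x₃₁) : x₁₂ ∈ V₁ ∧ x₁₂ ∈ V₂ :=
  h.inter₁₂.ge rfl

theorem junction_ne (h : IsTriangleGluing K G₁ G₂ G₃ V₁ V₂ V₃ x₁₂ x₂₃ x₃₁) : x₁₂ ≠ x₃₁ := by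
  rintro rfl
  exact h.inter₁₂₃.le ⟨h.mem₁₂, h.rotate.rotate.mem₁₂.1⟩

theorem support_sup₂₃ (h : IsTriangleGluing K G₁ G₂ G₃ V₁ V₂ V₃ x₁₂ x₂₃ x₃₁) :
    (G₂ ⊔ G₃).support ⊆ V₂ ∪ V₃ := by
  rintro v ⟨w, hvw | hvw⟩
  · exact .inl (h.support₂ ⟨w, hvw⟩)
  · exact .inr (h.support₃ ⟨w, hvw⟩)

theorem inter_union₂₃ (h : IsTriangleGluing K G₁ G₂ G₃ V₁ V₂ V₃ x₁₂ x₂₃ x₃₁) :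
    V₁ ∩ (V₂ ∪ V₃) ⊆ {x₁₂, x₃₁} := by
  rw [Set.inter_union_distrib_left, h.inter₁₂, Set.inter_comm V₁, h.inter₃₁]
  rfl

theorem eq_sup_sup₂₃ (h : IsTriangleGluing K G₁ G₂ G₃ V₁ V₂ V₃ x₁₂ x₂₃ x₃₁) :
    K = G₁ ⊔ (G₂ ⊔ G₃) := by
  rw [h.eq_sup, sup_assoc]

theorem reachable₂₃_iff_of_mem₂ (h : IsTriangleGluing K G₁ G₂ G₃ V₁ V₂ V₃ x₁₂ x₂₃ x₃₁)
    (hw : w ∈ V₂) : (G₂ ⊔ G₃).Reachable x₁₂ w ↔ G₂.Reachable x₁₂ w :=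
  reachable_sup_iff_of_inter_subset_singleton h.support₂ h.support₃ h.inter₂₃.le h.mem₁₂.2 hw

theorem reachable₂₃_iff_of_mem₃ (h : IsTriangleGluing K G₁ G₂ G₃ V₁ V₂ V₃ x₁₂ x₂₃ x₃₁)
    (hw : w ∈ V₃) :
    (G₂ ⊔ G₃).Reachable x₁₂ w ↔ G₂.Reachable x₁₂ x₂₃ ∧ G₃.Reachable x₂₃ w := by
  rw [reachable_sup_iff_of_mem_of_mem h.support₂ h.support₃
    (h.inter₂₃.trans (Set.pair_eq_singleton x₂₃).symm).le h.mem₁₂.2 hw, or_self]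

theorem reachable_iff_of_mem₁_of_mem₁ (h : IsTriangleGluing K G₁ G₂ G₃ V₁ V₂ V₃ x₁₂ x₂₃ x₃₁)
    (hu : u ∈ V₁) (hw : w ∈ V₁) :
    K.Reachable u w ↔ G₁.Reachable u w ∨ (G₂.Reachable x₁₂ x₂₃ ∧ G₃.Reachable x₂₃ x₃₁) ∧
      (G₁.Reachable u x₁₂ ∧ G₁.Reachable x₃₁ w ∨ G₁.Reachable u x₃₁ ∧ G₁.Reachable x₁₂ w) := by
  rw [h.eq_sup_sup₂₃,
    reachable_sup_iff_of_mem_left h.support₁ h.support_sup₂₃ h.inter_union₂₃ hu hw,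
    h.reachable₂₃_iff_of_mem₃ h.rotate.rotate.mem₁₂.1]

theorem reachable_iff_of_mem₁_of_mem₂ (h : IsTriangleGluing K G₁ G₂ G₃ V₁ V₂ V₃ x₁₂ x₂₃ x₃₁)
    (hu : u ∈ V₁) (hw : w ∈ V₂) :
    K.Reachable u w ↔ G₁.Reachable u x₁₂ ∧ G₂.Reachable x₁₂ w ∨
      G₁.Reachable u x₃₁ ∧ G₃.Reachable x₃₁ x₂₃ ∧ G₂.Reachable x₂₃ w := by
  have around : (G₂ ⊔ G₃).Reachable x₃₁ w ↔ G₃.Reachable x₃₁ x₂₃ ∧ G₂.Reachable x₂₃ w := by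
    rw [sup_comm, reachable_sup_iff_of_mem_of_mem h.support₃ h.support₂
      (q := x₂₃) (by rw [Set.pair_eq_singleton, Set.inter_comm, h.inter₂₃])
      h.rotate.rotate.mem₁₂.1 hw, or_self]
  rw [h.eq_sup_sup₂₃, reachable_sup_iff_of_mem_of_mem h.support₁ h.support_sup₂₃ h.inter_union₂₃
    hu (.inl hw), h.reachable₂₃_iff_of_mem₂ hw, around]

theorem reachable_iff_of_mem₂_of_mem₁ (h : IsTriangleGluing K G₁ G₂ G₃ V₁ V₂ V₃ x₁₂ x₂₃ x₃₁)
    (hu : u ∈ V₂) (hw : w ∈ V₁) :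
    K.Reachable u w ↔ G₂.Reachable u x₁₂ ∧ G₁.Reachable x₁₂ w ∨
      G₂.Reachable u x₂₃ ∧ G₃.Reachable x₂₃ x₃₁ ∧ G₁.Reachable x₃₁ w := by
  rw [K.reachable_comm, h.reachable_iff_of_mem₁_of_mem₂ hw hu]
  grind only [SimpleGraph.reachable_comm]

theorem disjoint₁₂ (h : IsTriangleGluing K G₁ G₂ G₃ V₁ V₂ V₃ x₁₂ x₂₃ x₃₁) : Disjoint G₁ G₂ :=
  disjoint_of_support_subset h.support₁ h.support₂ h.inter₁₂.le

theorem isAcyclic_iff (h : IsTriangleGluing K G₁ G₂ G₃ V₁ V₂ V₃ x₁₂ x₂₃ x₃₁) :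
    K.IsAcyclic ↔ (G₁.IsAcyclic ∧ G₂.IsAcyclic ∧ G₃.IsAcyclic) ∧
      ¬(G₁.Reachable x₁₂ x₃₁ ∧ G₂.Reachable x₁₂ x₂₃ ∧ G₃.Reachable x₂₃ x₃₁) := by
  have disjoint : Disjoint G₁ (G₂ ⊔ G₃) :=
    disjoint_sup_right.2 ⟨h.disjoint₁₂, h.rotate.rotate.disjoint₁₂.symm⟩
  rw [h.eq_sup_sup₂₃, isAcyclic_sup_iff h.support₁ h.support_sup₂₃ h.inter_union₂₃ disjoint,
    isAcyclic_sup_iff h.support₂ h.support₃ (h.inter₂₃.trans (Set.pair_eq_singleton x₂₃).symm).le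
      h.rotate.disjoint₁₂, h.reachable₂₃_iff_of_mem₃ h.rotate.rotate.mem₁₂.1]
  have := h.junction_ne
  tauto

theorem reachable_of_reachable₁ (h : IsTriangleGluing K G₁ G₂ G₃ V₁ V₂ V₃ x₁₂ x₂₃ x₃₁)
    (huw : G₁.Reachable u w) : K.Reachable u w := by
  rw [h.eq_sup_sup₂₃]
  exact huw.mono le_sup_left

end IsTriangleGluing

/-! ## Forests described by their corner pattern -/

section Map

variable {V V' : Type*} {G : SimpleGraph V} (f : V ↪ V')

theorem reachable_map_iff {u v : V} : (G.map f).Reachable (f u) (f v) ↔ G.Reachable u v := by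
  refine ⟨fun h => ?_, fun h => h.map (SimpleGraph.Embedding.map f G).toHom⟩
  have exists_preimage (y : V') (h : (G.map f).Reachable (f u) y) :
      ∃ w, f w = y ∧ G.Reachable u w := by
    induction (SimpleGraph.reachable_iff_reflTransGen _ _).1 h with
    | refl => exact ⟨u, rfl, .refl u⟩
    | tail hx hxy ih =>
      obtain ⟨w, rfl, huw⟩ := ih ((SimpleGraph.reachable_iff_reflTransGen _ _).2 hx)
      obtain ⟨w', z, hwz, hw', rfl⟩ := (SimpleGraph.map_adj f G _ _).1 hxy
      exact ⟨z, rfl, huw.trans (f.injective hw' ▸ hwz).reachable⟩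
  obtain ⟨w, hw, huw⟩ := exists_preimage (f v) h
  exact f.injective hw ▸ huw

theorem isAcyclic_map_iff : (G.map f).IsAcyclic ↔ G.IsAcyclic := by
  refine ⟨SimpleGraph.IsAcyclic.of_map f, fun h => ?_⟩
  simp only [SimpleGraph.isAcyclic_iff_forall_adj_isBridge, SimpleGraph.map_adj,
    SimpleGraph.isBridge_iff] at h ⊢
  rintro _ _ ⟨u, v, huv, rfl, rfl⟩
  have map_delete : (G.map f).deleteEdges {s(f u, f v)} = (G.deleteEdges {s(u, v)}).map f := by
    rw [← SimpleGraph.edgeSet_inj, SimpleGraph.edgeSet_deleteEdges, SimpleGraph.edgeSet_map,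
      SimpleGraph.edgeSet_map, SimpleGraph.edgeSet_deleteEdges, Set.image_sdiff f.sym2Map.injective,
      Set.image_singleton]
    rfl
  rw [map_delete, reachable_map_iff]
  exact h huv

end Map

/-- How a spanning forest of a triangle, all of whose trees contain a corner, connects the corners
`o`, `a`, `b`: a single tree, one corner in a tree of its own, or three trees. -/
inductive CornerPattern
  | joined
  | bIsolated
  | aIsolated
  | oIsolated
  | separated
  deriving DecidableEq

namespace CornerPattern

instance : Fintype CornerPattern where
  elems := {joined, bIsolated, aIsolated, oIsolated, separated}
  complete := by rintro ⟨⟩ <;> decide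

/-- The corners `o` and `a` are in the same tree. -/
@[simp]
def oa : CornerPattern → Bool
  | joined | bIsolated => true
  | _ => false

/-- The corners `o` and `b` are in the same tree. -/
@[simp]
def ob : CornerPattern → Bool
  | joined | aIsolated => true
  | _ => false

/-- The corners `a` and `b` are in the same tree. -/
@[simp]
def ab : CornerPattern → Bool
  | joined | oIsolated => true
  | _ => false

/-- Forests with patterns `p₁`, `p₂`, `p₃` on the lower left, lower right and top copies of a
triangle glue to a forest with pattern `p`: the three links between junctions do not close a cycle,
each of the three junctions is linked to a corner of the large triangle, and the corners are
linked as `p` prescribes, directly or around the hole. -/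
def Glues (p₁ p₂ p₃ p : CornerPattern) : Prop :=
  ¬(p₁.ab ∧ p₂.ob ∧ p₃.oa) ∧
  (p₁.oa ∨ p₂.oa ∨ p₁.ab ∧ (p₃.ob ∨ p₃.oa ∧ p₂.ab) ∨ p₂.ob ∧ (p₃.ab ∨ p₃.oa ∧ p₁.ob)) ∧
  (p₂.ab ∨ p₃.ab ∨ p₂.ob ∧ (p₁.oa ∨ p₁.ab ∧ p₃.ob) ∨ p₃.oa ∧ (p₁.ob ∨ p₁.ab ∧ p₂.oa)) ∧
  (p₃.ob ∨ p₁.ob ∨ p₃.oa ∧ (p₂.ab ∨ p₂.ob ∧ p₁.oa) ∨ p₁.ab ∧ (p₂.oa ∨ p₂.ob ∧ p₃.ab)) ∧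
  (p.oa ↔ p₁.oa ∧ p₂.oa ∨ p₁.ob ∧ p₃.oa ∧ p₂.ab) ∧
  (p.ob ↔ p₁.ob ∧ p₃.ob ∨ p₁.oa ∧ p₂.ob ∧ p₃.ab) ∧
  (p.ab ↔ p₂.ab ∧ p₃.ab ∨ p₂.oa ∧ p₁.ab ∧ p₃.ob)
  deriving Decidable

end CornerPattern

section CornerForest

variable {V : Type*} {G : SimpleGraph V} {W : Set V} {o a b : V} {p q : CornerPattern}

/-- Reachability in `G` among the corners `o`, `a`, `b` is given by the pattern `p`. -/
structure LinksCorners (G : SimpleGraph V) (o a b : V) (p : CornerPattern) : Prop where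
  oa : G.Reachable o a ↔ p.oa
  ob : G.Reachable o b ↔ p.ob
  ab : G.Reachable a b ↔ p.ab

theorem LinksCorners.ao (h : LinksCorners G o a b p) : G.Reachable a o ↔ p.oa :=
  G.reachable_comm.trans h.oa

theorem LinksCorners.bo (h : LinksCorners G o a b p) : G.Reachable b o ↔ p.ob :=
  G.reachable_comm.trans h.ob

theorem LinksCorners.ba (h : LinksCorners G o a b p) : G.Reachable b a ↔ p.ab :=
  G.reachable_comm.trans h.ab

theorem LinksCorners.unique (hp : LinksCorners G o a b p) (hq : LinksCorners G o a b q) :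
    p = q := by
  have oa := hp.oa.symm.trans hq.oa
  have ob := hp.ob.symm.trans hq.ob
  have ab := hp.ab.symm.trans hq.ab
  clear hp hq
  revert p q
  decide

theorem exists_linksCorners (G : SimpleGraph V) (o a b : V) : ∃ p, LinksCorners G o a b p := by
  have oa_ob (h : G.Reachable o a) (h' : G.Reachable o b) : G.Reachable a b := h.symm.trans h'
  have oa_ab (h : G.Reachable o a) (h' : G.Reachable a b) : G.Reachable o b := h.trans h'
  have ob_ab (h : G.Reachable o b) (h' : G.Reachable a b) : G.Reachable o a := h.trans h'.symm
  by_cases oa : G.Reachable o a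
  · by_cases ob : G.Reachable o b
    · exact ⟨.joined, by simp [oa], by simp [ob], by simp [oa_ob oa ob]⟩
    · exact ⟨.bIsolated, by simp [oa], by simp [ob], by simp [mt (oa_ab oa) ob]⟩
  · by_cases ob : G.Reachable o b
    · exact ⟨.aIsolated, by simp [oa], by simp [ob], by simp [mt (ob_ab ob) oa]⟩
    · by_cases ab : G.Reachable a b
      · exact ⟨.oIsolated, by simp [oa], by simp [ob], by simp [ab]⟩
      · exact ⟨.separated, by simp [oa], by simp [ob], by simp [ab]⟩

/-- `G` is a forest in which every vertex of `W` lies in the tree of one of the corners `o`, `a`,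
`b`, and these are connected according to the pattern `p`. -/
structure IsCornerForest (G : SimpleGraph V) (W : Set V) (o a b : V) (p : CornerPattern) : Prop
    extends LinksCorners G o a b p where
  isAcyclic : G.IsAcyclic
  covers : ∀ w ∈ W, G.Reachable w o ∨ G.Reachable w a ∨ G.Reachable w b

theorem LinksCorners.isCornerForest_iff (h : LinksCorners G o a b q) :
    IsCornerForest G W o a b p ↔ p = q ∧ G.IsAcyclic ∧
      ∀ w ∈ W, G.Reachable w o ∨ G.Reachable w a ∨ G.Reachable w b := by
  refine ⟨fun hp => ⟨hp.toLinksCorners.unique h, hp.isAcyclic, hp.covers⟩, ?_⟩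
  rintro ⟨rfl, isAcyclic, covers⟩
  exact { h with isAcyclic, covers }

theorem isCornerForest_map_iff {V' : Type*} (f : V ↪ V') :
    IsCornerForest (G.map f) (f '' W) (f o) (f a) (f b) p ↔ IsCornerForest G W o a b p := by
  constructor
  · rintro ⟨⟨oa, ob, ab⟩, acyclic, covers⟩
    simp only [Set.forall_mem_image, reachable_map_iff, isAcyclic_map_iff]
      at oa ob ab acyclic covers
    exact ⟨⟨oa, ob, ab⟩, acyclic, covers⟩
  · rintro ⟨⟨oa, ob, ab⟩, acyclic, covers⟩
    refine ⟨⟨?_, ?_, ?_⟩, ?_, ?_⟩ <;>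
      simpa only [Set.forall_mem_image, reachable_map_iff, isAcyclic_map_iff]

end CornerForest

namespace IsTriangleGluing

variable {V : Type*} {K G₁ G₂ G₃ : SimpleGraph V} {V₁ V₂ V₃ : Set V} {x₁₂ x₂₃ x₃₁ t₁ t₂ t₃ : V}
  {p₁ p₂ p₃ p : CornerPattern}

theorem junction_reachable_corner_iff
    (h : IsTriangleGluing K G₁ G₂ G₃ V₁ V₂ V₃ x₁₂ x₂₃ x₃₁) (ht₁ : t₁ ∈ V₁) (ht₂ : t₂ ∈ V₂)
    (ht₃ : t₃ ∈ V₃) :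
    K.Reachable x₁₂ t₁ ∨ K.Reachable x₁₂ t₂ ∨ K.Reachable x₁₂ t₃ ↔
      G₁.Reachable x₁₂ t₁ ∨ G₂.Reachable x₁₂ t₂ ∨
        G₁.Reachable x₁₂ x₃₁ ∧ (G₃.Reachable x₃₁ t₃ ∨
          G₃.Reachable x₃₁ x₂₃ ∧ G₂.Reachable x₂₃ t₂) ∨
        G₂.Reachable x₁₂ x₂₃ ∧ (G₃.Reachable x₂₃ t₃ ∨
          G₃.Reachable x₂₃ x₃₁ ∧ G₁.Reachable x₃₁ t₁) := by
  have refl₁ : G₁.Reachable x₁₂ x₁₂ := .refl x₁₂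
  have refl₂ : G₂.Reachable x₁₂ x₁₂ := .refl x₁₂
  have comm₃ := G₃.reachable_comm (u := x₂₃) (v := x₃₁)
  rw [h.reachable_iff_of_mem₁_of_mem₁ h.mem₁₂.1 ht₁,
    h.rotate.reachable_iff_of_mem₁_of_mem₁ h.mem₁₂.2 ht₂,
    h.rotate.rotate.reachable_iff_of_mem₂_of_mem₁ h.mem₁₂.1 ht₃]
  tauto

theorem covers_piece_iff (h : IsTriangleGluing K G₁ G₂ G₃ V₁ V₂ V₃ x₁₂ x₂₃ x₃₁) (ht₁ : t₁ ∈ V₁)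
    (ht₂ : t₂ ∈ V₂) (ht₃ : t₃ ∈ V₃) :
    (∀ w ∈ V₁, K.Reachable w t₁ ∨ K.Reachable w t₂ ∨ K.Reachable w t₃) ↔
      (∀ w ∈ V₁, G₁.Reachable w t₁ ∨ G₁.Reachable w x₁₂ ∨ G₁.Reachable w x₃₁) ∧
      (K.Reachable x₁₂ t₁ ∨ K.Reachable x₁₂ t₂ ∨ K.Reachable x₁₂ t₃) ∧
      (K.Reachable x₃₁ t₁ ∨ K.Reachable x₃₁ t₂ ∨ K.Reachable x₃₁ t₃) := by
  refine ⟨fun covers => ⟨fun w hw => ?_, covers _ h.mem₁₂.1, covers _ h.rotate.rotate.mem₁₂.2⟩, ?_⟩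
  · have := covers w hw
    rw [h.reachable_iff_of_mem₁_of_mem₁ hw ht₁, h.reachable_iff_of_mem₁_of_mem₂ hw ht₂,
      h.rotate.rotate.reachable_iff_of_mem₂_of_mem₁ hw ht₃] at this
    tauto
  · rintro ⟨covers, exit₁₂, exit₃₁⟩ w hw
    rcases covers w hw with hw | hw | hw
    · exact .inl (h.reachable_of_reachable₁ hw)
    · have trans {t : V} := (h.reachable_of_reachable₁ hw).trans (w := t)
      exact exit₁₂.imp trans (.imp trans trans)
    · have trans {t : V} := (h.reachable_of_reachable₁ hw).trans (w := t)
      exact exit₃₁.imp trans (.imp trans trans)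

theorem linksCorners_iff (h : IsTriangleGluing K G₁ G₂ G₃ V₁ V₂ V₃ x₁₂ x₂₃ x₃₁) (ht₁ : t₁ ∈ V₁)
    (ht₂ : t₂ ∈ V₂) (ht₃ : t₃ ∈ V₃) (h₁ : LinksCorners G₁ t₁ x₁₂ x₃₁ p₁)
    (h₂ : LinksCorners G₂ x₁₂ t₂ x₂₃ p₂) (h₃ : LinksCorners G₃ x₃₁ x₂₃ t₃ p₃) :
    LinksCorners K t₁ t₂ t₃ p ↔
      (p.oa ↔ p₁.oa ∧ p₂.oa ∨ p₁.ob ∧ p₃.oa ∧ p₂.ab) ∧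
      (p.ob ↔ p₁.ob ∧ p₃.ob ∨ p₁.oa ∧ p₂.ob ∧ p₃.ab) ∧
      (p.ab ↔ p₂.ab ∧ p₃.ab ∨ p₂.oa ∧ p₁.ab ∧ p₃.ob) := by
  have oa : K.Reachable t₁ t₂ ↔ p₁.oa ∧ p₂.oa ∨ p₁.ob ∧ p₃.oa ∧ p₂.ab := by
    rw [h.reachable_iff_of_mem₁_of_mem₂ ht₁ ht₂, h₁.oa, h₂.oa, h₁.ob, h₃.oa, h₂.ba]
  have ob : K.Reachable t₁ t₃ ↔ p₁.ob ∧ p₃.ob ∨ p₁.oa ∧ p₂.ob ∧ p₃.ab := by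
    rw [h.rotate.rotate.reachable_iff_of_mem₂_of_mem₁ ht₁ ht₃, h₁.ob, h₃.ob, h₁.oa, h₂.ob, h₃.ab]
  have ab : K.Reachable t₂ t₃ ↔ p₂.ab ∧ p₃.ab ∨ p₂.oa ∧ p₁.ab ∧ p₃.ob := by
    rw [h.rotate.reachable_iff_of_mem₁_of_mem₂ ht₂ ht₃, h₂.ab, h₃.ab, h₂.ao, h₁.ab, h₃.ob]
  refine ⟨fun hK => ⟨hK.oa.symm.trans oa, hK.ob.symm.trans ob, hK.ab.symm.trans ab⟩, ?_⟩
  exact fun ⟨hoa, hob, hab⟩ => ⟨oa.trans hoa.symm, ob.trans hob.symm, ab.trans hab.symm⟩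

theorem covers_iff (h : IsTriangleGluing K G₁ G₂ G₃ V₁ V₂ V₃ x₁₂ x₂₃ x₃₁) (ht₁ : t₁ ∈ V₁)
    (ht₂ : t₂ ∈ V₂) (ht₃ : t₃ ∈ V₃) (h₁ : LinksCorners G₁ t₁ x₁₂ x₃₁ p₁)
    (h₂ : LinksCorners G₂ x₁₂ t₂ x₂₃ p₂) (h₃ : LinksCorners G₃ x₃₁ x₂₃ t₃ p₃) :
    (∀ w ∈ V₁ ∪ V₂ ∪ V₃, K.Reachable w t₁ ∨ K.Reachable w t₂ ∨ K.Reachable w t₃) ↔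
      ((∀ w ∈ V₁, G₁.Reachable w t₁ ∨ G₁.Reachable w x₁₂ ∨ G₁.Reachable w x₃₁) ∧
        (∀ w ∈ V₂, G₂.Reachable w x₁₂ ∨ G₂.Reachable w t₂ ∨ G₂.Reachable w x₂₃) ∧
        (∀ w ∈ V₃, G₃.Reachable w x₃₁ ∨ G₃.Reachable w x₂₃ ∨ G₃.Reachable w t₃)) ∧
      (p₁.oa ∨ p₂.oa ∨ p₁.ab ∧ (p₃.ob ∨ p₃.oa ∧ p₂.ab) ∨ p₂.ob ∧ (p₃.ab ∨ p₃.oa ∧ p₁.ob)) ∧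
      (p₂.ab ∨ p₃.ab ∨ p₂.ob ∧ (p₁.oa ∨ p₁.ab ∧ p₃.ob) ∨ p₃.oa ∧ (p₁.ob ∨ p₁.ab ∧ p₂.oa)) ∧
      (p₃.ob ∨ p₁.ob ∨ p₃.oa ∧ (p₂.ab ∨ p₂.ob ∧ p₁.oa) ∨ p₁.ab ∧ (p₂.oa ∨ p₂.ob ∧ p₃.ab)) := by
  have piece₁ := h.covers_piece_iff ht₁ ht₂ ht₃
  have piece₂ := h.rotate.covers_piece_iff ht₂ ht₃ ht₁
  have piece₃ := h.rotate.rotate.covers_piece_iff ht₃ ht₁ ht₂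
  have exit₁₂ := h.junction_reachable_corner_iff ht₁ ht₂ ht₃
  have exit₂₃ := h.rotate.junction_reachable_corner_iff ht₂ ht₃ ht₁
  have exit₃₁ := h.rotate.rotate.junction_reachable_corner_iff ht₃ ht₁ ht₂
  simp only [h₁.ao, h₁.bo, h₁.ab, h₁.ba, h₂.oa, h₂.ob, h₂.bo, h₂.ba, h₃.oa, h₃.ao, h₃.ob,
    h₃.ab] at exit₁₂ exit₂₃ exit₃₁
  simp only [or_rotate (a := K.Reachable _ t₂), or_rotate (a := K.Reachable _ t₃),
    or_rotate (a := G₂.Reachable _ t₂), or_rotate (a := G₂.Reachable _ x₂₃),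
    or_rotate (a := G₃.Reachable _ t₃)] at piece₂ piece₃ exit₂₃ exit₃₁
  simp only [Set.mem_union, or_imp, forall_and, piece₁, piece₂, piece₃, exit₁₂, exit₂₃, exit₃₁]
  constructor
  · rintro ⟨⟨⟨c₁, e₁₂, e₃₁⟩, c₂, e₂₃, -⟩, c₃, -⟩
    exact ⟨⟨c₁, c₂, c₃⟩, e₁₂, e₂₃, e₃₁⟩
  · rintro ⟨⟨c₁, c₂, c₃⟩, e₁₂, e₂₃, e₃₁⟩
    exact ⟨⟨⟨c₁, e₁₂, e₃₁⟩, c₂, e₂₃, e₁₂⟩, c₃, e₃₁, e₂₃⟩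

theorem isCornerForest_iff (h : IsTriangleGluing K G₁ G₂ G₃ V₁ V₂ V₃ x₁₂ x₂₃ x₃₁) (ht₁ : t₁ ∈ V₁)
    (ht₂ : t₂ ∈ V₂) (ht₃ : t₃ ∈ V₃) :
    IsCornerForest K (V₁ ∪ V₂ ∪ V₃) t₁ t₂ t₃ p ↔
      ∃ p₁ p₂ p₃, (IsCornerForest G₁ V₁ t₁ x₁₂ x₃₁ p₁ ∧ IsCornerForest G₂ V₂ x₁₂ t₂ x₂₃ p₂ ∧
        IsCornerForest G₃ V₃ x₃₁ x₂₃ t₃ p₃) ∧ p₁.Glues p₂ p₃ p := by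
  obtain ⟨q₁, h₁⟩ := exists_linksCorners G₁ t₁ x₁₂ x₃₁
  obtain ⟨q₂, h₂⟩ := exists_linksCorners G₂ x₁₂ t₂ x₂₃
  obtain ⟨q₃, h₃⟩ := exists_linksCorners G₃ x₃₁ x₂₃ t₃
  have acyclic := h.isAcyclic_iff
  rw [h₁.ab, h₂.ob, h₃.ao] at acyclic
  have covers := h.covers_iff ht₁ ht₂ ht₃ h₁ h₂ h₃
  have links := h.linksCorners_iff (p := p) ht₁ ht₂ ht₃ h₁ h₂ h₃
  simp only [h₁.isCornerForest_iff, h₂.isCornerForest_iff, h₃.isCornerForest_iff]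
  constructor
  · intro hK
    obtain ⟨⟨a₁, a₂, a₃⟩, no_cycle⟩ := acyclic.1 hK.isAcyclic
    obtain ⟨⟨c₁, c₂, c₃⟩, exits⟩ := covers.1 hK.covers
    have links := links.1 hK.toLinksCorners
    exact ⟨q₁, q₂, q₃, ⟨⟨rfl, a₁, c₁⟩, ⟨rfl, a₂, c₂⟩, ⟨rfl, a₃, c₃⟩⟩, no_cycle,
      exits.1, exits.2.1, exits.2.2, links⟩
  · rintro ⟨_, _, _, ⟨⟨rfl, a₁, c₁⟩, ⟨rfl, a₂, c₂⟩, ⟨rfl, a₃, c₃⟩⟩, no_cycle, e₁₂, e₂₃, e₃₁, l⟩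
    exact {
      links.2 l with
      isAcyclic := acyclic.2 ⟨⟨a₁, a₂, a₃⟩, no_cycle⟩
      covers := covers.2 ⟨⟨c₁, c₂, c₃⟩, e₁₂, e₂₃, e₃₁⟩ }

end IsTriangleGluing

/-! ## Gluing three copies of the gasket -/

section Gasket

section FromEdgeSet

variable {V V' : Type*} {S : Set (Sym2 V)} {W : Set V}

theorem support_fromEdgeSet_subset (h : ∀ e ∈ S, ∀ v ∈ e, v ∈ W) :
    (fromEdgeSet S).support ⊆ W := by
  rintro v ⟨w, hvw⟩
  exact h _ hvw.1 v (Sym2.mem_mk_left v w)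

theorem fromEdgeSet_image_sym2Map (f : V ↪ V') (S : Set (Sym2 V)) :
    fromEdgeSet (f.sym2Map '' S) = (fromEdgeSet S).map f := by
  ext u v
  simp only [SimpleGraph.fromEdgeSet_adj, SimpleGraph.map_adj, Set.mem_image]
  constructor
  · rintro ⟨⟨⟨x, y⟩, hxy, hf⟩, huv⟩
    rcases Sym2.eq_iff.1 hf with ⟨rfl, rfl⟩ | ⟨rfl, rfl⟩
    · exact ⟨x, y, ⟨hxy, fun h => huv (congrArg f h)⟩, rfl, rfl⟩
    · exact ⟨y, x, ⟨Sym2.eq_swap ▸ hxy, fun h => huv (congrArg f h)⟩, rfl, rfl⟩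
  · rintro ⟨x, y, ⟨hxy, hne⟩, rfl, rfl⟩
    exact ⟨⟨s(x, y), hxy, rfl⟩, f.injective.ne hne⟩

end FromEdgeSet

/-- The translation taking the lower left copy of `SG(n)` in `SG(n + 1)` to the lower right one. -/
abbrev shiftA (n : ℕ) : ℕ × ℕ ↪ ℕ × ℕ := addRightEmbedding (a n)

/-- The translation taking the lower left copy of `SG(n)` in `SG(n + 1)` to the top one. -/
abbrev shiftB (n : ℕ) : ℕ × ℕ ↪ ℕ × ℕ := addRightEmbedding (b n)

variable {n : ℕ} {S S₁ S₂ S₃ : Finset (Sym2 (ℕ × ℕ))} {x : ℕ × ℕ} {e : Sym2 (ℕ × ℕ)}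

theorem mem_verts_succ : x ∈ verts (n + 1) ↔
    x ∈ verts n ∨ x ∈ shiftA n '' verts n ∨ x ∈ shiftB n '' verts n := by
  simp only [verts, Finset.mem_union, Finset.mem_image, Set.mem_image, or_assoc]
  rfl

theorem coe_verts_succ (n : ℕ) : (verts (n + 1) : Set (ℕ × ℕ)) =
    (verts n : Set (ℕ × ℕ)) ∪ shiftA n '' verts n ∪ shiftB n '' verts n := by
  ext x
  rw [Finset.mem_coe, mem_verts_succ, Set.union_assoc]
  rfl

theorem mem_edges_succ : e ∈ edges (n + 1) ↔ e ∈ edges n ∨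
    e ∈ (edges n).map (shiftA n).sym2Map ∨ e ∈ (edges n).map (shiftB n).sym2Map := by
  simp only [edges, Finset.mem_union, Finset.mem_image, Finset.mem_map, or_assoc]
  rfl

theorem fst_add_snd_le_of_mem_verts (hx : x ∈ verts n) : x.1 + x.2 ≤ 2 ^ n := by
  induction n generalizing x with
  | zero =>
    simp only [verts, Finset.mem_insert, Finset.mem_singleton] at hx
    rcases hx with rfl | rfl | rfl <;> decide
  | succ n ih =>
    rw [pow_succ]
    rcases mem_verts_succ.1 hx with hx | ⟨y, hy, rfl⟩ | ⟨y, hy, rfl⟩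
    · exact (ih hx).trans (by lia)
    all_goals
      have := ih hy
      simp only [addRightEmbedding_apply, Prod.fst_add, Prod.snd_add, a, b]
      lia

theorem mem_verts_of_mem_of_mem_edges (he : e ∈ edges n) (hx : x ∈ e) : x ∈ verts n := by
  induction n generalizing x e with
  | zero =>
    simp only [edges, Finset.mem_insert, Finset.mem_singleton] at he
    rcases he with rfl | rfl | rfl <;> rcases Sym2.mem_iff.1 hx with rfl | rfl <;> simp [verts]
  | succ n ih =>
    rw [mem_verts_succ]
    simp only [mem_edges_succ, Finset.mem_map] at he
    rcases he with he | ⟨e', he', rfl⟩ | ⟨e', he', rfl⟩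
    · exact .inl (ih he hx)
    all_goals obtain ⟨y, hy, rfl⟩ := Sym2.mem_map.1 hx
    · exact .inr (.inl ⟨y, ih he' hy, rfl⟩)
    · exact .inr (.inr ⟨y, ih he' hy, rfl⟩)

theorem not_isDiag_of_mem_edges (he : e ∈ edges n) : ¬ e.IsDiag := by
  induction n generalizing e with
  | zero =>
    simp only [edges, Finset.mem_insert, Finset.mem_singleton] at he
    rcases he with rfl | rfl | rfl <;> simp
  | succ n ih =>
    simp only [mem_edges_succ, Finset.mem_map] at he
    rcases he with he | ⟨e, he, rfl⟩ | ⟨e, he, rfl⟩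
    · exact ih he
    all_goals exact (Sym2.isDiag_map (Function.Embedding.injective _)).not.2 (ih he)

theorem verts_inter_shiftA (n : ℕ) : (verts n : Set (ℕ × ℕ)) ∩ shiftA n '' verts n = {a n} := by
  refine Set.Subset.antisymm ?_ (Set.singleton_subset_iff.2 ⟨a_mem n, o, o_mem n, zero_add (a n)⟩)
  rintro _ ⟨hx, x, -, rfl⟩
  have := fst_add_snd_le_of_mem_verts hx
  simp only [addRightEmbedding_apply, a, Prod.fst_add, Prod.snd_add, add_zero,
    Set.mem_singleton_iff, add_eq_right, Prod.ext_iff, Prod.fst_zero, Prod.snd_zero] at this ⊢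
  lia

theorem shiftA_inter_shiftB (n : ℕ) :
    shiftA n '' verts n ∩ shiftB n '' verts n = {c n} := by
  refine Set.Subset.antisymm ?_ (Set.singleton_subset_iff.2
    ⟨⟨b n, b_mem n, by simp [a, b, c]⟩, ⟨a n, a_mem n, by simp [a, b, c]⟩⟩)
  rintro _ ⟨⟨x, hx, rfl⟩, y, hy, h⟩
  have := fst_add_snd_le_of_mem_verts hx
  have := fst_add_snd_le_of_mem_verts hy
  simp only [addRightEmbedding_apply, a, b, c, Prod.ext_iff, Prod.fst_add, Prod.snd_add, add_zero,
    Set.mem_singleton_iff, Nat.add_eq_right] at h ⊢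
  lia

theorem shiftB_inter_verts (n : ℕ) : shiftB n '' verts n ∩ (verts n : Set (ℕ × ℕ)) = {b n} := by
  refine Set.Subset.antisymm ?_ (Set.singleton_subset_iff.2 ⟨⟨o, o_mem n, zero_add (b n)⟩, b_mem n⟩)
  rintro _ ⟨⟨x, -, rfl⟩, hx⟩
  have := fst_add_snd_le_of_mem_verts hx
  simp only [addRightEmbedding_apply, b, Prod.fst_add, Prod.snd_add, add_zero,
    Set.mem_singleton_iff, add_eq_right, Prod.ext_iff, Prod.fst_zero, Prod.snd_zero] at this ⊢
  lia

/-- The subset of the bonds of `SG(n + 1)` consisting of `S₁`, `S₂`, `S₃` placed on the lower left,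
lower right and top copies of `SG(n)`. -/
def glue (n : ℕ) (S₁ S₂ S₃ : Finset (Sym2 (ℕ × ℕ))) : Finset (Sym2 (ℕ × ℕ)) :=
  S₁ ∪ S₂.map (shiftA n).sym2Map ∪ S₃.map (shiftB n).sym2Map

theorem mem_glue : e ∈ glue n S₁ S₂ S₃ ↔
    e ∈ S₁ ∨ e ∈ S₂.map (shiftA n).sym2Map ∨ e ∈ S₃.map (shiftB n).sym2Map := by
  rw [glue, Finset.mem_union, Finset.mem_union, or_assoc]

theorem edges_succ (n : ℕ) : edges (n + 1) = glue n (edges n) (edges n) (edges n) :=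
  Finset.ext fun _ => mem_edges_succ.trans mem_glue.symm

theorem support_fromEdgeSet_subset_verts (hS : S ⊆ edges n) :
    (fromEdgeSet (S : Set (Sym2 (ℕ × ℕ)))).support ⊆ verts n :=
  support_fromEdgeSet_subset fun _ he _ hv => mem_verts_of_mem_of_mem_edges (hS he) hv

theorem isTriangleGluing_glue (h₁ : S₁ ⊆ edges n) (h₂ : S₂ ⊆ edges n) (h₃ : S₃ ⊆ edges n) :
    IsTriangleGluing (fromEdgeSet (glue n S₁ S₂ S₃ : Set (Sym2 (ℕ × ℕ)))) (fromEdgeSet S₁)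
      ((fromEdgeSet S₂).map (shiftA n)) ((fromEdgeSet S₃).map (shiftB n))
      (verts n) (shiftA n '' verts n) (shiftB n '' verts n) (a n) (c n) (b n) where
  eq_sup := by
    simp only [glue, Finset.coe_union, Finset.coe_map, SimpleGraph.fromEdgeSet_union,
      fromEdgeSet_image_sym2Map]
  support₁ := support_fromEdgeSet_subset_verts h₁
  support₂ := SimpleGraph.support_map _ _ ▸ Set.image_mono (support_fromEdgeSet_subset_verts h₂)
  support₃ := SimpleGraph.support_map _ _ ▸ Set.image_mono (support_fromEdgeSet_subset_verts h₃)
  inter₁₂ := verts_inter_shiftA n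
  inter₂₃ := shiftA_inter_shiftB n
  inter₃₁ := shiftB_inter_verts n
  inter₁₂₃ := by
    rw [verts_inter_shiftA, Set.eq_empty_iff_forall_notMem]
    rintro _ ⟨rfl, x, -, h⟩
    simp [a, b, Prod.ext_iff] at h

theorem isCornerForest_glue_iff {p : CornerPattern} (h₁ : S₁ ⊆ edges n) (h₂ : S₂ ⊆ edges n)
    (h₃ : S₃ ⊆ edges n) :
    IsCornerForest (fromEdgeSet (glue n S₁ S₂ S₃ : Set (Sym2 (ℕ × ℕ)))) (verts (n + 1)) o
        (a (n + 1)) (b (n + 1)) p ↔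
      ∃ p₁ p₂ p₃, (IsCornerForest (fromEdgeSet S₁) (verts n) o (a n) (b n) p₁ ∧
        IsCornerForest (fromEdgeSet S₂) (verts n) o (a n) (b n) p₂ ∧
        IsCornerForest (fromEdgeSet S₃) (verts n) o (a n) (b n) p₃) ∧ p₁.Glues p₂ p₃ p := by
  have shiftA_o : shiftA n o = a n := zero_add _
  have shiftA_a : shiftA n (a n) = a (n + 1) := by simp [a, pow_succ, mul_two]
  have shiftA_b : shiftA n (b n) = c n := by simp [a, b, c]
  have shiftB_o : shiftB n o = b n := zero_add _
  have shiftB_a : shiftB n (a n) = c n := by simp [a, b, c]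
  have shiftB_b : shiftB n (b n) = b (n + 1) := by simp [b, pow_succ, mul_two]
  have copy₂ (p) := isCornerForest_map_iff (G := fromEdgeSet S₂) (W := verts n) (o := o) (a := a n)
    (b := b n) (p := p) (shiftA n)
  have copy₃ (p) := isCornerForest_map_iff (G := fromEdgeSet S₃) (W := verts n) (o := o) (a := a n)
    (b := b n) (p := p) (shiftB n)
  rw [shiftA_o, shiftA_a, shiftA_b] at copy₂
  rw [shiftB_o, shiftB_a, shiftB_b] at copy₃
  have a_mem_right : a (n + 1) ∈ shiftA n '' verts n := ⟨a n, a_mem n, shiftA_a⟩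
  have b_mem_top : b (n + 1) ∈ shiftB n '' verts n := ⟨b n, b_mem n, shiftB_b⟩
  rw [coe_verts_succ,
    (isTriangleGluing_glue h₁ h₂ h₃).isCornerForest_iff (o_mem n) a_mem_right b_mem_top]
  simp only [copy₂, copy₃]

end Gasket

section Decomposition

section Sym2

variable {V : Type*} {x : V} {e : Sym2 V} {E E' : Finset (Sym2 V)} {W W' : Set V}

theorem isDiag_of_forall_mem_eq (h : ∀ v ∈ e, v = x) : e.IsDiag := by
  induction e with
  | h u v => exact (h u (Sym2.mem_mk_left u v)).trans (h v (Sym2.mem_mk_right u v)).symm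

theorem disjoint_of_inter_eq_singleton (hE : ∀ e ∈ E, ¬e.IsDiag) (hW : ∀ e ∈ E, ∀ v ∈ e, v ∈ W)
    (hW' : ∀ e ∈ E', ∀ v ∈ e, v ∈ W') (h : W ∩ W' = {x}) : Disjoint E E' :=
  Finset.disjoint_left.2 fun e he he' =>
    hE e he (isDiag_of_forall_mem_eq fun v hv => h.le ⟨hW e he v hv, hW' e he' v hv⟩)

theorem eq_of_union_eq_union_of_disjoint {ι : Type*} [DecidableEq ι]
    {E₁ E₂ E₃ S₁ S₂ S₃ T₁ T₂ T₃ : Finset ι} (h₁₂ : Disjoint E₁ E₂) (h₁₃ : Disjoint E₁ E₃)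
    (h₂₃ : Disjoint E₂ E₃) (hS₁ : S₁ ⊆ E₁) (hS₂ : S₂ ⊆ E₂) (hS₃ : S₃ ⊆ E₃) (hT₁ : T₁ ⊆ E₁)
    (hT₂ : T₂ ⊆ E₂) (hT₃ : T₃ ⊆ E₃) (h : S₁ ∪ S₂ ∪ S₃ = T₁ ∪ T₂ ∪ T₃) :
    S₁ = T₁ ∧ S₂ = T₂ ∧ S₃ = T₃ := by
  simp only [Finset.disjoint_left, Finset.subset_iff, Finset.ext_iff, Finset.mem_union] at *
  grind

end Sym2

variable {n : ℕ} {S S₁ S₂ S₃ T₁ T₂ T₃ : Finset (Sym2 (ℕ × ℕ))} {p : CornerPattern}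

theorem mem_image_verts_of_mem_map_edges (f : ℕ × ℕ ↪ ℕ × ℕ) :
    ∀ e ∈ (edges n).map f.sym2Map, ∀ v ∈ e, v ∈ f '' verts n := by
  simp only [Finset.forall_mem_map]
  intro e he _ hv
  obtain ⟨w, hw, rfl⟩ := Sym2.mem_map.1 hv
  exact ⟨w, mem_verts_of_mem_of_mem_edges he hw, rfl⟩

theorem disjoint_edges_map_shiftA (n : ℕ) : Disjoint (edges n) ((edges n).map (shiftA n).sym2Map) :=
  disjoint_of_inter_eq_singleton (fun _ => not_isDiag_of_mem_edges)
    (fun _ he _ => mem_verts_of_mem_of_mem_edges he) (mem_image_verts_of_mem_map_edges (shiftA n))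
    (verts_inter_shiftA n)

theorem disjoint_edges_map_shiftB (n : ℕ) : Disjoint (edges n) ((edges n).map (shiftB n).sym2Map) :=
  disjoint_of_inter_eq_singleton (fun _ => not_isDiag_of_mem_edges)
    (fun _ he _ => mem_verts_of_mem_of_mem_edges he) (mem_image_verts_of_mem_map_edges (shiftB n))
    ((Set.inter_comm _ _).trans (shiftB_inter_verts n))

theorem disjoint_map_shiftA_map_shiftB (n : ℕ) :
    Disjoint ((edges n).map (shiftA n).sym2Map) ((edges n).map (shiftB n).sym2Map) := by
  refine disjoint_of_inter_eq_singleton ?_ (mem_image_verts_of_mem_map_edges (shiftA n))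
    (mem_image_verts_of_mem_map_edges (shiftB n)) (shiftA_inter_shiftB n)
  simp only [Finset.forall_mem_map]
  exact fun e he => (Sym2.isDiag_map (shiftA n).injective).not.2 (not_isDiag_of_mem_edges he)

theorem glue_subset_edges (h₁ : S₁ ⊆ edges n) (h₂ : S₂ ⊆ edges n) (h₃ : S₃ ⊆ edges n) :
    glue n S₁ S₂ S₃ ⊆ edges (n + 1) := by
  rw [edges_succ, glue, glue]
  gcongr

theorem glue_injective (hS₁ : S₁ ⊆ edges n) (hS₂ : S₂ ⊆ edges n) (hS₃ : S₃ ⊆ edges n)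
    (hT₁ : T₁ ⊆ edges n) (hT₂ : T₂ ⊆ edges n) (hT₃ : T₃ ⊆ edges n)
    (h : glue n S₁ S₂ S₃ = glue n T₁ T₂ T₃) : S₁ = T₁ ∧ S₂ = T₂ ∧ S₃ = T₃ := by
  obtain ⟨eq₁, eq₂, eq₃⟩ := eq_of_union_eq_union_of_disjoint (disjoint_edges_map_shiftA n)
    (disjoint_edges_map_shiftB n) (disjoint_map_shiftA_map_shiftB n) hS₁
    (Finset.map_subset_map.2 hS₂) (Finset.map_subset_map.2 hS₃) hT₁
    (Finset.map_subset_map.2 hT₂) (Finset.map_subset_map.2 hT₃) h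
  exact ⟨eq₁, Finset.map_injective _ eq₂, Finset.map_injective _ eq₃⟩

theorem exists_glue_eq (hS : S ⊆ edges (n + 1)) :
    ∃ S₁ ⊆ edges n, ∃ S₂ ⊆ edges n, ∃ S₃ ⊆ edges n, glue n S₁ S₂ S₃ = S := by
  have exists_map (f : ℕ × ℕ ↪ ℕ × ℕ) : ∃ T ⊆ edges n,
      S ∩ (edges n).map f.sym2Map = T.map f.sym2Map := by
    obtain ⟨T, hT, h⟩ := Finset.subset_map_iff.1
      (Finset.inter_subset_right (s₁ := S) (s₂ := (edges n).map f.sym2Map))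
    exact ⟨T, hT, h⟩
  obtain ⟨S₂, h₂, hS₂⟩ := exists_map (shiftA n)
  obtain ⟨S₃, h₃, hS₃⟩ := exists_map (shiftB n)
  refine ⟨S ∩ edges n, Finset.inter_subset_right, S₂, h₂, S₃, h₃, ?_⟩
  rw [glue, ← hS₂, ← hS₃, ← Finset.inter_union_distrib_left, ← Finset.inter_union_distrib_left]
  exact Finset.inter_eq_left.2 (hS.trans (edges_succ n).le)

open Classical in
/-- The spanning forests of `SG(n)`, given by their bonds, all of whose trees contain a corner and
which connect the corners `o`, `a_n`, `b_n` according to `p`. -/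
noncomputable def forests (n : ℕ) (p : CornerPattern) : Finset (Finset (Sym2 (ℕ × ℕ))) :=
  (edges n).powerset.filter fun S =>
    IsCornerForest (fromEdgeSet (S : Set (Sym2 (ℕ × ℕ)))) (verts n) o (a n) (b n) p

theorem mem_forests : S ∈ forests n p ↔ S ⊆ edges n ∧
    IsCornerForest (fromEdgeSet (S : Set (Sym2 (ℕ × ℕ)))) (verts n) o (a n) (b n) p := by
  simp only [forests, Finset.mem_filter, Finset.mem_powerset]

theorem mem_forests_succ : S ∈ forests (n + 1) p ↔ ∃ p₁ p₂ p₃, p₁.Glues p₂ p₃ p ∧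
    ∃ S₁ ∈ forests n p₁, ∃ S₂ ∈ forests n p₂, ∃ S₃ ∈ forests n p₃, glue n S₁ S₂ S₃ = S := by
  constructor
  · intro hS
    obtain ⟨hS, forest⟩ := mem_forests.1 hS
    obtain ⟨S₁, h₁, S₂, h₂, S₃, h₃, rfl⟩ := exists_glue_eq hS
    obtain ⟨p₁, p₂, p₃, ⟨f₁, f₂, f₃⟩, hp⟩ := (isCornerForest_glue_iff h₁ h₂ h₃).1 forest
    exact ⟨p₁, p₂, p₃, hp, S₁, mem_forests.2 ⟨h₁, f₁⟩, S₂, mem_forests.2 ⟨h₂, f₂⟩, S₃,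
      mem_forests.2 ⟨h₃, f₃⟩, rfl⟩
  · rintro ⟨p₁, p₂, p₃, hp, S₁, hS₁, S₂, hS₂, S₃, hS₃, rfl⟩
    obtain ⟨h₁, f₁⟩ := mem_forests.1 hS₁
    obtain ⟨h₂, f₂⟩ := mem_forests.1 hS₂
    obtain ⟨h₃, f₃⟩ := mem_forests.1 hS₃
    exact mem_forests.2 ⟨glue_subset_edges h₁ h₂ h₃,
      (isCornerForest_glue_iff h₁ h₂ h₃).2 ⟨p₁, p₂, p₃, ⟨f₁, f₂, f₃⟩, hp⟩⟩

theorem eq_of_mem_forests {q : CornerPattern} (hp : S ∈ forests n p) (hq : S ∈ forests n q) :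
    p = q :=
  (mem_forests.1 hp).2.toLinksCorners.unique (mem_forests.1 hq).2.toLinksCorners

/-- If the number of forests with pattern `q` on the lower left, lower right and top copies of a
triangle is `t₁ q`, `t₂ q`, `t₃ q`, then `glueSum t₁ t₂ t₃ p` is the number of forests with
pattern `p` on the large triangle. -/
def glueSum {M : Type*} [CommSemiring M] (t₁ t₂ t₃ : CornerPattern → M) (p : CornerPattern) : M :=
  ∑ q : CornerPattern × CornerPattern × CornerPattern with q.1.Glues q.2.1 q.2.2 p,
    t₁ q.1 * (t₂ q.2.1 * t₃ q.2.2)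

open Finset (card_product card_sigma mem_sigma mem_filter mem_univ mem_product) in
theorem card_filter_forests_succ {P P₁ P₂ P₃ : Finset (Sym2 (ℕ × ℕ)) → Prop} [DecidablePred P]
    [DecidablePred P₁] [DecidablePred P₂] [DecidablePred P₃]
    (hP : ∀ S₁ ⊆ edges n, ∀ S₂ ⊆ edges n, ∀ S₃ ⊆ edges n,
      P (glue n S₁ S₂ S₃) ↔ P₁ S₁ ∧ P₂ S₂ ∧ P₃ S₃) (p : CornerPattern) :
    ((forests (n + 1) p).filter P).card =
      glueSum (fun q => ((forests n q).filter P₁).card) (fun q => ((forests n q).filter P₂).card)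
        (fun q => ((forests n q).filter P₃).card) p := by
  simp only [glueSum, ← card_product, ← card_sigma]
  symm
  refine Finset.card_bij (fun x _ => glue n x.2.1 x.2.2.1 x.2.2.2) ?_ ?_ ?_
  · rintro ⟨⟨p₁, p₂, p₃⟩, S₁, S₂, S₃⟩ h
    simp only [mem_sigma, mem_filter, mem_univ, true_and, mem_product] at h ⊢
    obtain ⟨hp, ⟨f₁, hP₁⟩, ⟨f₂, hP₂⟩, f₃, hP₃⟩ := h
    exact ⟨mem_forests_succ.2 ⟨p₁, p₂, p₃, hp, S₁, f₁, S₂, f₂, S₃, f₃, rfl⟩,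
      (hP S₁ (mem_forests.1 f₁).1 S₂ (mem_forests.1 f₂).1 S₃ (mem_forests.1 f₃).1).2
        ⟨hP₁, hP₂, hP₃⟩⟩
  · rintro ⟨⟨p₁, p₂, p₃⟩, S₁, S₂, S₃⟩ hS ⟨⟨q₁, q₂, q₃⟩, T₁, T₂, T₃⟩ hT h
    simp only [mem_sigma, mem_filter, mem_product] at hS hT
    obtain ⟨-, ⟨f₁, -⟩, ⟨f₂, -⟩, f₃, -⟩ := hS
    obtain ⟨-, ⟨g₁, -⟩, ⟨g₂, -⟩, g₃, -⟩ := hT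
    obtain ⟨rfl, rfl, rfl⟩ := glue_injective (mem_forests.1 f₁).1 (mem_forests.1 f₂).1
      (mem_forests.1 f₃).1 (mem_forests.1 g₁).1 (mem_forests.1 g₂).1 (mem_forests.1 g₃).1 h
    rw [eq_of_mem_forests f₁ g₁, eq_of_mem_forests f₂ g₂, eq_of_mem_forests f₃ g₃]
  · intro S hS
    obtain ⟨hS, hPS⟩ := mem_filter.1 hS
    obtain ⟨p₁, p₂, p₃, hp, S₁, f₁, S₂, f₂, S₃, f₃, rfl⟩ := mem_forests_succ.1 hS
    obtain ⟨hP₁, hP₂, hP₃⟩ := (hP S₁ (mem_forests.1 f₁).1 S₂ (mem_forests.1 f₂).1 S₃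
      (mem_forests.1 f₃).1).1 hPS
    exact ⟨⟨(p₁, p₂, p₃), S₁, S₂, S₃⟩, by simp [*], rfl⟩

end Decomposition

/-! ## Counting forests by corner pattern -/

section Counting

section SingleEdge

variable {V : Type*} {u v w : V} (S : Set (Sym2 V))

theorem reachable_fromEdgeSet_inter_singleton (huv : u ≠ v) :
    (fromEdgeSet (S ∩ {s(u, v)})).Reachable u v ↔ s(u, v) ∈ S := by
  by_cases h : s(u, v) ∈ S
  · refine iff_of_true (SimpleGraph.Adj.reachable ?_) h
    exact (SimpleGraph.fromEdgeSet_adj _).2 ⟨⟨h, rfl⟩, huv⟩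
  · rw [Set.inter_singleton_eq_empty.2 h, SimpleGraph.fromEdgeSet_empty, SimpleGraph.reachable_bot]
    exact iff_of_false huv h

theorem isAcyclic_fromEdgeSet_inter_singleton (huv : u ≠ v) :
    (fromEdgeSet (S ∩ {s(u, v)})).IsAcyclic := by
  have isAcyclic_edge : (⊥ ⊔ SimpleGraph.edge u v).IsAcyclic :=
    SimpleGraph.isAcyclic_bot.sup_edge_of_not_reachable (SimpleGraph.reachable_bot.not.2 huv)
  rw [bot_sup_eq] at isAcyclic_edge
  exact isAcyclic_edge.anti (SimpleGraph.fromEdgeSet_mono Set.inter_subset_right)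

theorem support_fromEdgeSet_inter_singleton_subset (u v : V) :
    (fromEdgeSet (S ∩ {s(u, v)})).support ⊆ {u, v} :=
  support_fromEdgeSet_subset fun _ he _ hx => Sym2.mem_iff.1 (he.2 ▸ hx)

theorem isTriangleGluing_fromEdgeSet (huv : u ≠ v) (hvw : v ≠ w) (huw : u ≠ w)
    (hS : S ⊆ {s(u, v), s(v, w), s(w, u)}) :
    IsTriangleGluing (fromEdgeSet S) (fromEdgeSet (S ∩ {s(u, v)})) (fromEdgeSet (S ∩ {s(v, w)}))
      (fromEdgeSet (S ∩ {s(w, u)})) {u, v} {v, w} {w, u} v w u where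
  eq_sup := by
    rw [← SimpleGraph.fromEdgeSet_union, ← SimpleGraph.fromEdgeSet_union,
      ← Set.inter_union_distrib_left, ← Set.inter_union_distrib_left, Set.inter_eq_left.2]
    exact hS.trans_eq (by
      ext
      simp only [Set.mem_insert_iff, Set.mem_singleton_iff, Set.union_singleton]
      tauto)
  support₁ := support_fromEdgeSet_inter_singleton_subset S u v
  support₂ := support_fromEdgeSet_inter_singleton_subset S v w
  support₃ := support_fromEdgeSet_inter_singleton_subset S w u
  inter₁₂ := by
    ext
    simp only [Set.mem_inter_iff, Set.mem_insert_iff, Set.mem_singleton_iff]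
    grind
  inter₂₃ := by
    ext
    simp only [Set.mem_inter_iff, Set.mem_insert_iff, Set.mem_singleton_iff]
    grind
  inter₃₁ := by
    ext
    simp only [Set.mem_inter_iff, Set.mem_insert_iff, Set.mem_singleton_iff]
    grind
  inter₁₂₃ := by
    ext
    simp only [Set.mem_inter_iff, Set.mem_insert_iff, Set.mem_singleton_iff,
      Set.mem_empty_iff_false, iff_false, not_and, not_or, and_imp]
    grind

variable {S} {p : CornerPattern}

theorem isCornerForest_fromEdgeSet_iff [∀ e, Decidable (e ∈ S)] (huv : u ≠ v) (hvw : v ≠ w)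
    (huw : u ≠ w) (hS : S ⊆ {s(u, v), s(v, w), s(w, u)}) :
    IsCornerForest (fromEdgeSet S) {u, v, w} u v w p ↔
      (if s(u, v) ∈ S then .joined else .aIsolated : CornerPattern).Glues
        (if s(v, w) ∈ S then .joined else .bIsolated)
        (if s(w, u) ∈ S then .joined else .oIsolated) p := by
  have links₁ : LinksCorners (fromEdgeSet (S ∩ {s(u, v)})) u v u
      (if s(u, v) ∈ S then .joined else .aIsolated) := by
    have link := reachable_fromEdgeSet_inter_singleton S huv
    generalize fromEdgeSet _ = G at link ⊢
    split_ifs with h <;> constructor <;> simp [h, link, SimpleGraph.reachable_comm (u := v)]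
  have links₂ : LinksCorners (fromEdgeSet (S ∩ {s(v, w)})) v v w
      (if s(v, w) ∈ S then .joined else .bIsolated) := by
    have link := reachable_fromEdgeSet_inter_singleton S hvw
    generalize fromEdgeSet _ = G at link ⊢
    split_ifs with h <;> constructor <;> simp [h, link]
  have links₃ : LinksCorners (fromEdgeSet (S ∩ {s(w, u)})) u w w
      (if s(w, u) ∈ S then .joined else .oIsolated) := by
    have link := reachable_fromEdgeSet_inter_singleton S huw.symm
    generalize fromEdgeSet _ = G at link ⊢
    split_ifs with h <;> constructor <;> simp [h, link, SimpleGraph.reachable_comm (u := u)]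
  have union_eq : ({u, v, w} : Set V) = {u, v} ∪ {v, w} ∪ {w, u} := by
    ext
    simp only [Set.mem_insert_iff, Set.mem_singleton_iff, Set.union_insert, Set.union_singleton,
      or_true, Set.insert_eq_of_mem, true_or]
    tauto
  rw [union_eq, (isTriangleGluing_fromEdgeSet S huv hvw huw hS).isCornerForest_iff (.inl rfl)
    (.inl rfl) (.inl rfl)]
  simp only [links₁.isCornerForest_iff, links₂.isCornerForest_iff, links₃.isCornerForest_iff,
    isAcyclic_fromEdgeSet_inter_singleton S huv, isAcyclic_fromEdgeSet_inter_singleton S hvw,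
    isAcyclic_fromEdgeSet_inter_singleton S huw.symm]
  simp

end SingleEdge

theorem edges_zero : edges 0 = {s(o, a 0), s(a 0, b 0), s(b 0, o)} := by
  ext e
  simp only [edges, o, a, b, pow_zero, Finset.mem_insert, Finset.mem_singleton,
    Sym2.eq_swap (a := (0, 1))]
  tauto

theorem card_forests_zero (p : CornerPattern) :
    (forests 0 p).card = if p = .joined then 3 else 1 := by
  have forests_zero : forests 0 p =
      ({s(o, a 0), s(a 0, b 0), s(b 0, o)} : Finset (Sym2 (ℕ × ℕ))).powerset.filter fun S =>
        (if s(o, a 0) ∈ S then .joined else .aIsolated : CornerPattern).Glues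
          (if s(a 0, b 0) ∈ S then .joined else .bIsolated)
          (if s(b 0, o) ∈ S then .joined else .oIsolated) p := by
    have verts_zero : (verts 0 : Set (ℕ × ℕ)) = {o, a 0, b 0} := by simp [verts, o, a, b]
    ext S
    rw [mem_forests, Finset.mem_filter, Finset.mem_powerset, edges_zero, verts_zero]
    refine and_congr_right fun hS => ?_
    exact isCornerForest_fromEdgeSet_iff (S := (S : Set (Sym2 (ℕ × ℕ)))) (by decide) (by decide)
      (by decide) (by simpa [← Finset.coe_subset] using hS)
  rw [forests_zero]
  clear forests_zero
  revert p
  decide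

end Counting

section Weights

variable {n : ℕ} {x : ℕ × ℕ} {S S₁ S₂ S₃ : Finset (Sym2 (ℕ × ℕ))} {f r : ℚ}

/-- The numbers of forests of `SG(n)` with each pattern, where `f` is the number of spanning trees
and `r` the ratio to it of the number of forests with two trees. -/
@[simp]
def cornerWeight (f r : ℚ) : CornerPattern → ℚ
  | .joined => f
  | .separated => 3 * f * r ^ 2
  | _ => f * r

theorem cornerWeight_pos (hf : 0 < f) (hr : 0 < r) (p : CornerPattern) :
    0 < cornerWeight f r p := by
  cases p <;> simp only [cornerWeight] <;> positivity

theorem CornerPattern.sum_univ {M : Type*} [AddCommMonoid M] (t : CornerPattern → M) :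
    ∑ p, t p = t .joined + (t .bIsolated + (t .aIsolated + (t .oIsolated + t .separated))) := by
  have univ_eq : (Finset.univ : Finset CornerPattern) =
      {.joined, .bIsolated, .aIsolated, .oIsolated, .separated} := rfl
  simp [univ_eq]

theorem glueSum_cornerWeight (f r : ℚ) (p : CornerPattern) :
    glueSum (cornerWeight f r) (cornerWeight f r) (cornerWeight f r) p =
      cornerWeight (6 * f ^ 3 * r) (5 / 3 * r) p := by
  cases p <;>
    simp [glueSum, Finset.sum_filter, Fintype.sum_prod_type, CornerPattern.sum_univ,
      CornerPattern.Glues] <;> ring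

theorem card_forests_succ (n : ℕ) (p : CornerPattern) : (forests (n + 1) p).card =
    glueSum (fun q => (forests n q).card) (fun q => (forests n q).card)
      (fun q => (forests n q).card) p := by
  simpa only [Finset.filter_true] using card_filter_forests_succ (n := n) (P := fun _ => True)
    (P₁ := fun _ => True) (P₂ := fun _ => True) (P₃ := fun _ => True) (by simp) p

theorem cast_glueSum (t₁ t₂ t₃ : CornerPattern → ℕ) (p : CornerPattern) :
    ((glueSum t₁ t₂ t₃ p : ℕ) : ℚ) =
      glueSum (fun q => (t₁ q : ℚ)) (fun q => (t₂ q : ℚ)) (fun q => (t₃ q : ℚ)) p := by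
  simp [glueSum]

theorem exists_card_forests_eq_cornerWeight (n : ℕ) :
    ∃ f r : ℚ, 0 < f ∧ 0 < r ∧ ∀ p, ((forests n p).card : ℚ) = cornerWeight f r p := by
  induction n with
  | zero =>
    refine ⟨3, 1 / 3, by norm_num, by norm_num, fun p => ?_⟩
    rw [card_forests_zero]
    cases p <;> (simp only [reduceCtorEq, if_true, if_false, cornerWeight]; norm_num)
  | succ n ih =>
    obtain ⟨f, r, hf, hr, card_eq⟩ := ih
    refine ⟨6 * f ^ 3 * r, 5 / 3 * r, by positivity, by positivity, fun p => ?_⟩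
    rw [card_forests_succ, cast_glueSum]
    simp only [card_eq]
    exact glueSum_cornerWeight f r p

theorem bonds_union_of_forall_notMem_right {T : Finset (Sym2 (ℕ × ℕ))} (h : ∀ e ∈ T, x ∉ e) :
    bonds (S ∪ T) x = bonds S x := by
  simp only [bonds, Finset.filter_union, Finset.filter_eq_empty_iff.2 @h, Finset.union_empty]

theorem bonds_union_of_forall_notMem_left {T : Finset (Sym2 (ℕ × ℕ))} (h : ∀ e ∈ S, x ∉ e) :
    bonds (S ∪ T) x = bonds T x := by
  rw [Finset.union_comm, bonds_union_of_forall_notMem_right h]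

theorem bonds_map (f : ℕ × ℕ ↪ ℕ × ℕ) (S : Finset (Sym2 (ℕ × ℕ))) (x : ℕ × ℕ) :
    bonds (S.map f.sym2Map) (f x) = bonds S x := by
  simp [bonds, Finset.filter_map]

theorem bonds_glue_of_lt (hx₁ : x.1 < 2 ^ n) (hx₂ : x.2 < 2 ^ n) :
    bonds (glue n S₁ S₂ S₃) x = bonds S₁ x := by
  rw [glue, bonds_union_of_forall_notMem_right, bonds_union_of_forall_notMem_right] <;>
    simp only [Finset.forall_mem_map]
  all_goals
    intro e _ hx
    obtain ⟨y, -, rfl⟩ := Sym2.mem_map.1 hx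
    simp [a, b] at hx₁ hx₂

theorem bonds_glue_shiftA (h₁ : S₁ ⊆ edges n) (hx : x ≠ o) (hx₂ : x.2 < 2 ^ n) :
    bonds (glue n S₁ S₂ S₃) (shiftA n x) = bonds S₂ x := by
  rw [glue, bonds_union_of_forall_notMem_right, bonds_union_of_forall_notMem_left, bonds_map]
  · intro e he h
    have := fst_add_snd_le_of_mem_verts (mem_verts_of_mem_of_mem_edges (h₁ he) h)
    simp only [addRightEmbedding_apply, a, Prod.fst_add, Prod.snd_add, add_zero, o, ne_eq,
      Prod.ext_iff, not_and] at this hx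
    lia
  · simp only [Finset.forall_mem_map]
    intro e _ h
    obtain ⟨y, -, h⟩ := Sym2.mem_map.1 h
    simp only [addRightEmbedding_apply, a, b, Prod.ext_iff, Prod.fst_add, Prod.snd_add,
      add_zero] at h
    lia

end Weights

/-! ## The transfer matrices -/

section Transfer

variable {n : ℕ} {x : ℕ × ℕ} {i : Fin 5}

/-- The pattern of the forests counted in the `i`-th column of `B`. -/
def columnPattern : Fin 5 → CornerPattern :=
  ![.joined, .bIsolated, .aIsolated, .oIsolated, .separated]

theorem glueSum_mul_right_eq_vecMul_R (f r : ℚ) (t : CornerPattern → ℚ) (i : Fin 5) :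
    glueSum (cornerWeight f r) (fun q => cornerWeight f r q * t q) (cornerWeight f r)
        (columnPattern i) =
      cornerWeight (6 * f ^ 3 * r) (5 / 3 * r) (columnPattern i) *
        Matrix.vecMul (fun k => t (columnPattern k)) R i := by
  fin_cases i <;>
    simp [columnPattern, glueSum, Finset.sum_filter, Fintype.sum_prod_type, CornerPattern.sum_univ,
      CornerPattern.Glues, Matrix.vecMul, dotProduct, Fin.sum_univ_five, R] <;>
    ring

theorem glueSum_mul_left_eq_vecMul_L (f r : ℚ) (t : CornerPattern → ℚ) (hi : i ≠ 3) :
    glueSum (fun q => cornerWeight f r q * t q) (cornerWeight f r) (cornerWeight f r)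
        (columnPattern i) =
      cornerWeight (6 * f ^ 3 * r) (5 / 3 * r) (columnPattern i) *
        Matrix.vecMul (fun k => t (columnPattern k)) L i := by
  have cases_i : i = 0 ∨ i = 1 ∨ i = 2 ∨ i = 4 := by lia
  rcases cases_i with rfl | rfl | rfl | rfl <;>
    simp [columnPattern, glueSum, Finset.sum_filter, Fintype.sum_prod_type, CornerPattern.sum_univ,
      CornerPattern.Glues, Matrix.vecMul, dotProduct, Fin.sum_univ_five, L] <;>
    ring

/-- The proportion of forests with `j` bonds at `x` among the forests of `SG(n)` with pattern
`p`. -/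
noncomputable def proportion (j n : ℕ) (x : ℕ × ℕ) (p : CornerPattern) : ℚ :=
  (((forests n p).filter fun S => bonds S x = j).card : ℚ) / ((forests n p).card : ℚ)

/-- The proportions of forests with `j` bonds at `x`, in the order of the columns of `B`. -/
noncomputable def profile (j n : ℕ) (x : ℕ × ℕ) : Fin 5 → ℚ :=
  fun i => proportion j n x (columnPattern i)

theorem card_forests_pos (n : ℕ) (p : CornerPattern) : (0 : ℚ) < (forests n p).card := by
  obtain ⟨f, r, hf, hr, card_eq⟩ := exists_card_forests_eq_cornerWeight n
  exact card_eq p ▸ cornerWeight_pos hf hr p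

theorem card_filter_bonds_eq (j n : ℕ) (x : ℕ × ℕ) (p : CornerPattern) :
    (((forests n p).filter fun S => bonds S x = j).card : ℚ) =
      (forests n p).card * proportion j n x p :=
  (mul_div_cancel₀ _ (card_forests_pos n p).ne').symm

theorem profile_succ_shiftA (j : ℕ) (hx : x ≠ o) (hx₂ : x.2 < 2 ^ n) :
    profile j (n + 1) (shiftA n x) = Matrix.vecMul (profile j n x) R := by
  funext i
  have card_right := card_filter_forests_succ (n := n) (P := fun S => bonds S (shiftA n x) = j)
    (P₁ := fun _ => True) (P₂ := fun S => bonds S x = j) (P₃ := fun _ => True)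
    (fun S₁ h₁ S₂ _ S₃ _ => by rw [bonds_glue_shiftA h₁ hx hx₂]; tauto) (columnPattern i)
  obtain ⟨f, r, -, -, card_eq⟩ := exists_card_forests_eq_cornerWeight n
  rw [profile, proportion, div_eq_iff (card_forests_pos _ _).ne', card_right, card_forests_succ,
    cast_glueSum, cast_glueSum]
  simp only [Finset.filter_true, card_filter_bonds_eq, card_eq, glueSum_cornerWeight]
  rw [glueSum_mul_right_eq_vecMul_R, mul_comm]
  rfl

theorem profile_succ_apply_of_lt (j : ℕ) (hx₁ : x.1 < 2 ^ n) (hx₂ : x.2 < 2 ^ n) (hi : i ≠ 3) :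
    profile j (n + 1) x i = Matrix.vecMul (profile j n x) L i := by
  have card_left := card_filter_forests_succ (n := n) (P := fun S => bonds S x = j)
    (P₁ := fun S => bonds S x = j) (P₂ := fun _ => True) (P₃ := fun _ => True)
    (fun S₁ _ S₂ _ S₃ _ => by rw [bonds_glue_of_lt hx₁ hx₂]; tauto) (columnPattern i)
  obtain ⟨f, r, -, -, card_eq⟩ := exists_card_forests_eq_cornerWeight n
  rw [profile, proportion, div_eq_iff (card_forests_pos _ _).ne', card_left, card_forests_succ,
    cast_glueSum, cast_glueSum]
  simp only [Finset.filter_true, card_filter_bonds_eq, card_eq, glueSum_cornerWeight]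
  rw [glueSum_mul_left_eq_vecMul_L _ _ _ hi, mul_comm]
  rfl

theorem L_apply_eq_zero {k : Fin 5} (hk : 3 ≤ k) (hi : i < 3) : L k i = 0 := by
  fin_cases k <;> fin_cases i <;> first | rfl | simp at hk hi

/- The fourth column of `L` does not describe the fourth entry of `profile`. As the first three
columns vanish in the last two rows, this does not affect the first three entries. -/
theorem profile_add_apply_of_lt (j m : ℕ) (hx₁ : x.1 < 2 ^ n) (hx₂ : x.2 < 2 ^ n) (hi : i < 3) :
    profile j (n + m) x i = Matrix.vecMul (profile j n x) (L ^ m) i := by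
  induction m generalizing i with
  | zero => simp
  | succ m ih =>
    have pow_le : 2 ^ n ≤ 2 ^ (n + m) := Nat.pow_le_pow_right two_pos (n.le_add_right m)
    rw [← add_assoc, profile_succ_apply_of_lt j (hx₁.trans_le pow_le) (hx₂.trans_le pow_le) hi.ne,
      pow_succ, ← Matrix.vecMul_vecMul]
    simp only [Matrix.vecMul_eq_sum (v := profile j (n + m) x), Matrix.vecMul_eq_sum (M := L),
      Finset.sum_apply, Pi.smul_apply, smul_eq_mul]
    refine Finset.sum_congr rfl fun k _ => ?_
    rcases lt_or_ge k 3 with hk | hk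
    · rw [ih hk]
    · simp [L_apply_eq_zero hk hi]

end Transfer

/-! ## Spanning trees and forests as corner forests -/

section Spanning

section Components

variable {V : Type*} {G : SimpleGraph V} {o a b : V}

theorem card_connectedComponent_eq_iff [Finite V] {k : ℕ} {f : Fin k → V}
    (hf : ∀ i j, G.Reachable (f i) (f j) → i = j) :
    Nat.card G.ConnectedComponent = k ↔ ∀ v, ∃ i, G.Reachable v (f i) := by
  have injective : Function.Injective fun i => G.connectedComponentMk (f i) := fun i j h =>
    hf i j (SimpleGraph.ConnectedComponent.exact h)
  constructor
  · intro h v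
    have bijective := injective.bijective_of_nat_card_le (by simp [h])
    obtain ⟨i, hi⟩ := bijective.2 (G.connectedComponentMk v)
    exact ⟨i, SimpleGraph.ConnectedComponent.exact hi.symm⟩
  · intro h
    have surjective : Function.Surjective fun i => G.connectedComponentMk (f i) := by
      rintro ⟨v⟩
      exact (h v).imp fun i hi => SimpleGraph.ConnectedComponent.sound hi.symm
    rw [← Nat.card_eq_of_bijective _ ⟨injective, surjective⟩, Nat.card_fin]

theorem isCornerForest_univ_joined_iff :
    IsCornerForest G Set.univ o a b .joined ↔ G.IsTree := by
  have : Nonempty V := ⟨o⟩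
  rw [SimpleGraph.isTree_iff, SimpleGraph.connected_iff_exists_forall_reachable]
  constructor
  · rintro ⟨⟨oa, ob, -⟩, acyclic, covers⟩
    simp only [CornerPattern.oa, CornerPattern.ob, iff_true] at oa ob
    refine ⟨⟨o, fun v => ?_⟩, acyclic⟩
    rcases covers v trivial with h | h | h
    · exact h.symm
    · exact oa.trans h.symm
    · exact ob.trans h.symm
  · rintro ⟨⟨v, hv⟩, acyclic⟩
    have reachable (x y : V) : G.Reachable x y := (hv x).symm.trans (hv y)
    exact ⟨⟨by simp [reachable], by simp [reachable], by simp [reachable]⟩, acyclic,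
      fun w _ => .inl (reachable w o)⟩

theorem isCornerForest_univ_bIsolated_iff [Finite V] :
    IsCornerForest G Set.univ o a b .bIsolated ↔ G.IsAcyclic ∧
      Nat.card G.ConnectedComponent = 2 ∧ G.Reachable o a ∧ ¬G.Reachable o b := by
  have card_eq (ob : ¬G.Reachable o b) : Nat.card G.ConnectedComponent = 2 ↔
      ∀ v, G.Reachable v o ∨ G.Reachable v b := by
    rw [card_connectedComponent_eq_iff (f := ![o, b])]
    · simp only [Fin.exists_fin_two, Matrix.cons_val_zero, Matrix.cons_val_one]
    · intro i j
      fin_cases i <;> fin_cases j <;> simp [ob, G.reachable_comm (u := b)]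
  constructor
  · rintro ⟨⟨oa, ob, -⟩, acyclic, covers⟩
    simp only [CornerPattern.oa, CornerPattern.ob, iff_true, Bool.false_eq_true, iff_false] at oa ob
    refine ⟨acyclic, (card_eq ob).2 fun v => ?_, oa, ob⟩
    rcases covers v trivial with h | h | h
    · exact .inl h
    · exact .inl (h.trans oa.symm)
    · exact .inr h
  · rintro ⟨acyclic, card, oa, ob⟩
    have ab : ¬G.Reachable a b := fun h => ob (oa.trans h)
    exact ⟨⟨by simp [oa], by simp [ob], by simp [ab]⟩, acyclic,
      fun v _ => ((card_eq ob).1 card v).imp_right .inr⟩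

theorem isCornerForest_univ_separated_iff [Finite V] :
    IsCornerForest G Set.univ o a b .separated ↔ G.IsAcyclic ∧
      Nat.card G.ConnectedComponent = 3 ∧ ¬G.Reachable o a ∧ ¬G.Reachable o b ∧
        ¬G.Reachable a b := by
  have card_eq (oa : ¬G.Reachable o a) (ob : ¬G.Reachable o b) (ab : ¬G.Reachable a b) :
      Nat.card G.ConnectedComponent = 3 ↔
        ∀ v, G.Reachable v o ∨ G.Reachable v a ∨ G.Reachable v b := by
    rw [card_connectedComponent_eq_iff (f := ![o, a, b])]
    · simp [Fin.exists_fin_succ]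
    · intro i j
      fin_cases i <;> fin_cases j <;>
        simp [oa, ob, ab, mt G.reachable_comm.1 oa, mt G.reachable_comm.1 ob,
          mt G.reachable_comm.1 ab]
  constructor
  · rintro ⟨⟨oa, ob, ab⟩, acyclic, covers⟩
    simp only [CornerPattern.oa, CornerPattern.ob, CornerPattern.ab, Bool.false_eq_true,
      iff_false] at oa ob ab
    exact ⟨acyclic, (card_eq oa ob ab).2 fun v => covers v trivial, oa, ob, ab⟩
  · rintro ⟨acyclic, card, oa, ob, ab⟩
    exact ⟨⟨by simp [oa], by simp [ob], by simp [ab]⟩, acyclic,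
      fun v _ => (card_eq oa ob ab).1 card v⟩

end Components

variable {n : ℕ} {S : Finset (Sym2 (ℕ × ℕ))} {p : CornerPattern}

theorem map_spanSub (hS : S ⊆ edges n) :
    (spanSub n S).map (Function.Embedding.subtype (· ∈ verts n)) =
      fromEdgeSet (S : Set (Sym2 (ℕ × ℕ))) := by
  refine SimpleGraph.ext (funext₂ fun u v => propext ?_)
  rw [SimpleGraph.map_adj]
  constructor
  · rintro ⟨u, v, h, rfl, rfl⟩
    exact h
  · intro h
    have support := support_fromEdgeSet_subset_verts hS
    exact ⟨⟨u, support ⟨v, h⟩⟩, ⟨v, support ⟨u, h.symm⟩⟩, h, rfl, rfl⟩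

theorem isCornerForest_spanSub_iff (hS : S ⊆ edges n) :
    IsCornerForest (spanSub n S) Set.univ (oV n) (aV n) (bV n) p ↔
      IsCornerForest (fromEdgeSet (S : Set (Sym2 (ℕ × ℕ)))) (verts n) o (a n) (b n) p := by
  rw [← isCornerForest_map_iff (Function.Embedding.subtype (· ∈ verts n)), map_spanSub hS,
    Set.image_univ]
  exact iff_of_eq (congrArg (IsCornerForest _ · _ _ _ _) Subtype.range_coe)

theorem eq_forests_of_mem_iff {E : Finset (Finset (Sym2 (ℕ × ℕ)))}
    (h : ∀ S, S ∈ E ↔ S ⊆ edges n ∧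
      IsCornerForest (spanSub n S) Set.univ (oV n) (aV n) (bV n) p) :
    E = forests n p := by
  ext S
  rw [h, mem_forests]
  exact and_congr_right isCornerForest_spanSub_iff

open Classical in
theorem trees_eq_forests (n : ℕ) : trees n = forests n .joined :=
  eq_forests_of_mem_iff fun S => by
    rw [trees, Finset.mem_filter, Finset.mem_powerset, isCornerForest_univ_joined_iff]

open Classical in
theorem forests₂_eq_forests (n : ℕ) : forests₂ n = forests n .bIsolated :=
  eq_forests_of_mem_iff fun S => by
    rw [forests₂, Finset.mem_filter, Finset.mem_powerset, isCornerForest_univ_bIsolated_iff]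

open Classical in
theorem forests₃_eq_forests (n : ℕ) : forests₃ n = forests n .separated :=
  eq_forests_of_mem_iff fun S => by
    rw [forests₃, Finset.mem_filter, Finset.mem_powerset, isCornerForest_univ_separated_iff]

theorem F_eq_proportion (j n : ℕ) (x : ℕ × ℕ) : F j n x = proportion j n x .joined := by
  rw [F, trees_eq_forests, proportion]

theorem G_eq_proportion (j n : ℕ) (x : ℕ × ℕ) : G j n x = proportion j n x .bIsolated := by
  rw [G, forests₂_eq_forests, proportion]

theorem H_eq_proportion (j n : ℕ) (x : ℕ × ℕ) : H j n x = proportion j n x .separated := by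
  rw [H, forests₃_eq_forests, proportion]

end Spanning

/-! ## Reflections -/

section Symmetry

namespace CornerPattern

/-- The pattern obtained by exchanging the corners `a` and `b`. -/
def swapAB : CornerPattern → CornerPattern
  | aIsolated => bIsolated
  | bIsolated => aIsolated
  | p => p

/-- The pattern obtained by exchanging the corners `o` and `b`. -/
def swapOB : CornerPattern → CornerPattern
  | oIsolated => bIsolated
  | bIsolated => oIsolated
  | p => p

theorem swapAB_swapAB (p : CornerPattern) : p.swapAB.swapAB = p := by
  cases p <;> rfl

theorem swapOB_swapOB (p : CornerPattern) : p.swapOB.swapOB = p := by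
  cases p <;> rfl

end CornerPattern

section CornerForest

variable {V : Type*} {G : SimpleGraph V} {W : Set V} {o a b : V} {p : CornerPattern}

theorem IsCornerForest.swapAB (h : IsCornerForest G W o a b p) :
    IsCornerForest G W o b a p.swapAB where
  oa := by rw [h.ob]; cases p <;> decide
  ob := by rw [h.oa]; cases p <;> decide
  ab := by rw [h.ba]; cases p <;> decide
  isAcyclic := h.isAcyclic
  covers w hw := (h.covers w hw).imp_right Or.symm

theorem IsCornerForest.swapOB (h : IsCornerForest G W o a b p) :
    IsCornerForest G W b a o p.swapOB where
  oa := by rw [h.ba]; cases p <;> decide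
  ob := by rw [h.bo]; cases p <;> decide
  ab := by rw [h.ao]; cases p <;> decide
  isAcyclic := h.isAcyclic
  covers w hw := by have := h.covers w hw; tauto

theorem isCornerForest_swapAB_iff :
    IsCornerForest G W o b a p.swapAB ↔ IsCornerForest G W o a b p :=
  ⟨fun h => p.swapAB_swapAB ▸ h.swapAB, IsCornerForest.swapAB⟩

theorem isCornerForest_swapOB_iff :
    IsCornerForest G W b a o p.swapOB ↔ IsCornerForest G W o a b p :=
  ⟨fun h => p.swapOB_swapOB ▸ h.swapOB, IsCornerForest.swapOB⟩

end CornerForest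

variable {n : ℕ} {p q : CornerPattern} {f : ℕ × ℕ ↪ ℕ × ℕ}

/-- `f` permutes the vertices and the bonds of `SG(n)`. -/
structure IsSymmetry (n : ℕ) (f : ℕ × ℕ ↪ ℕ × ℕ) : Prop where
  map_verts : (verts n).map f = verts n
  map_edges : (edges n).map f.sym2Map = edges n

theorem IsSymmetry.isCornerForest_map_iff (hf : IsSymmetry n f) {S : Finset (Sym2 (ℕ × ℕ))} :
    IsCornerForest (fromEdgeSet (S.map f.sym2Map : Set (Sym2 (ℕ × ℕ)))) (verts n) (f o) (f (a n))
        (f (b n)) p ↔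
      IsCornerForest (fromEdgeSet (S : Set (Sym2 (ℕ × ℕ)))) (verts n) o (a n) (b n) p := by
  have := SG.isCornerForest_map_iff (G := fromEdgeSet (S : Set (Sym2 (ℕ × ℕ)))) (W := verts n)
    (o := o) (a := a n) (b := b n) (p := p) f
  rwa [← fromEdgeSet_image_sym2Map, ← Finset.coe_map, ← Finset.coe_map, hf.map_verts] at this

theorem IsSymmetry.forests_eq_map (hf : IsSymmetry n f)
    (hpq : ∀ G : SimpleGraph (ℕ × ℕ), IsCornerForest G (verts n) o (a n) (b n) q ↔
      IsCornerForest G (verts n) (f o) (f (a n)) (f (b n)) p) :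
    forests n q = (forests n p).map (Finset.mapEmbedding f.sym2Map).toEmbedding := by
  ext S
  simp only [Finset.mem_map, mem_forests, RelEmbedding.coe_toEmbedding, Finset.mapEmbedding_apply,
    hpq]
  constructor
  · rintro ⟨hS, forest⟩
    obtain ⟨T, hT, rfl⟩ := Finset.subset_map_iff.1 (hS.trans hf.map_edges.ge)
    exact ⟨T, ⟨hT, hf.isCornerForest_map_iff.1 forest⟩, rfl⟩
  · rintro ⟨T, ⟨hT, forest⟩, rfl⟩
    exact ⟨(Finset.map_subset_map.2 hT).trans hf.map_edges.le, hf.isCornerForest_map_iff.2 forest⟩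

theorem IsSymmetry.proportion_apply (hf : IsSymmetry n f)
    (hpq : ∀ G : SimpleGraph (ℕ × ℕ), IsCornerForest G (verts n) o (a n) (b n) q ↔
      IsCornerForest G (verts n) (f o) (f (a n)) (f (b n)) p) (j : ℕ) (x : ℕ × ℕ) :
    proportion j n (f x) q = proportion j n x p := by
  rw [proportion, proportion, hf.forests_eq_map hpq, Finset.filter_map, Finset.card_map,
    Finset.card_map]
  simp only [Function.comp_def, RelEmbedding.coe_toEmbedding, Finset.mapEmbedding_apply, bonds_map]

/-- The embeddings of `SG(n)` into `SG(n + 1)` as the lower left, lower right and top copy. -/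
def copy (n : ℕ) : Fin 3 → ℕ × ℕ ↪ ℕ × ℕ :=
  ![.refl _, shiftA n, shiftB n]

theorem verts_succ_eq_biUnion_copy (n : ℕ) :
    verts (n + 1) = Finset.univ.biUnion fun i => (verts n).map (copy n i) := by
  ext x
  simp [mem_verts_succ, Fin.exists_fin_succ, copy, -Prod.exists]

theorem edges_succ_eq_biUnion_copy (n : ℕ) :
    edges (n + 1) = Finset.univ.biUnion fun i => (edges n).map (copy n i).sym2Map := by
  ext e
  simp [mem_edges_succ, Fin.exists_fin_succ, copy]

theorem map_biUnion_map_eq_of_permutes {ι α : Type*} [Fintype ι] [DecidableEq α] {E : Finset α}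
    {c : ι → α ↪ α} {s t : α ↪ α} (π : Equiv.Perm ι) (hs : E.map s = E)
    (hst : ∀ i, ∀ x ∈ E, t (c i x) = c (π i) (s x)) :
    (Finset.univ.biUnion fun i => E.map (c i)).map t =
      Finset.univ.biUnion fun i => E.map (c i) := by
  ext y
  simp only [Finset.mem_map, Finset.mem_biUnion, Finset.mem_univ, true_and]
  constructor
  · rintro ⟨_, ⟨i, x, hx, rfl⟩, rfl⟩
    exact ⟨π i, s x, hs.le (Finset.mem_map_of_mem s hx), (hst i x hx).symm⟩
  · rintro ⟨i, x, hx, rfl⟩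
    obtain ⟨i, rfl⟩ := π.surjective i
    obtain ⟨x, hx', rfl⟩ := Finset.mem_map.1 (hs.ge hx)
    exact ⟨c i x, ⟨i, x, hx', rfl⟩, hst i x hx'⟩

theorem isSymmetry_of_permutes_copies {σ : ℕ → ℕ × ℕ ↪ ℕ × ℕ} (zero : IsSymmetry 0 (σ 0))
    (π : Equiv.Perm (Fin 3))
    (hσ : ∀ n i, ∀ x ∈ verts n, σ (n + 1) (copy n i x) = copy n (π i) (σ n x)) (n : ℕ) :
    IsSymmetry n (σ n) := by
  induction n with
  | zero => exact zero
  | succ n ih =>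
    constructor
    · rw [verts_succ_eq_biUnion_copy]
      exact map_biUnion_map_eq_of_permutes π ih.map_verts (hσ n)
    · rw [edges_succ_eq_biUnion_copy]
      refine map_biUnion_map_eq_of_permutes π ih.map_edges fun i e he => ?_
      simp only [Function.Embedding.sym2Map_apply, Sym2.map_map]
      exact Sym2.map_congr fun x hx => hσ n i x (mem_verts_of_mem_of_mem_edges he hx)

/-- The reflection `tilde` as an embedding. -/
def tildeEmbedding : ℕ × ℕ ↪ ℕ × ℕ :=
  ⟨tilde, Prod.swap_injective⟩

theorem tildeEmbedding_apply (x : ℕ × ℕ) : tildeEmbedding x = (x.2, x.1) :=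
  rfl

theorem isSymmetry_tildeEmbedding (n : ℕ) : IsSymmetry n tildeEmbedding := by
  refine isSymmetry_of_permutes_copies (σ := fun _ => tildeEmbedding) ⟨?_, ?_⟩
    (Equiv.swap 1 2) (fun n i x _ => ?_) n
  · decide
  · rw [edges_zero]
    decide
  · fin_cases i <;> simp [copy, tildeEmbedding_apply, a, b, Equiv.swap_apply_of_ne_of_ne]

/-- The reflection `hat n` of `SG(n)` as an embedding: the points off the triangle, on which `hat n`
truncates the subtraction, are fixed instead. -/
def hatEmbedding (n : ℕ) : ℕ × ℕ ↪ ℕ × ℕ where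
  toFun x := if x.1 + x.2 ≤ 2 ^ n then hat n x else x
  inj' x y h := by
    simp only [hat] at h
    split_ifs at h <;> simp only [Prod.ext_iff] at h ⊢ <;> lia

theorem hatEmbedding_apply {x : ℕ × ℕ} (hx : x.1 + x.2 ≤ 2 ^ n) : hatEmbedding n x = hat n x :=
  if_pos hx

theorem copy_fst_add_snd_le (i : Fin 3) {x : ℕ × ℕ} (hx : x.1 + x.2 ≤ 2 ^ n) :
    (copy n i x).1 + (copy n i x).2 ≤ 2 ^ (n + 1) := by
  fin_cases i <;> simp [copy, a, b, pow_succ] <;> lia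

theorem hat_copy (i : Fin 3) {x : ℕ × ℕ} (hx : x.1 + x.2 ≤ 2 ^ n) :
    hat (n + 1) (copy n i x) = copy n (Equiv.swap 0 2 i) (hat n x) := by
  fin_cases i <;> ext <;>
    simp [copy, hat, a, b, pow_succ, Equiv.swap_apply_of_ne_of_ne] <;> lia

theorem isSymmetry_hatEmbedding (n : ℕ) : IsSymmetry n (hatEmbedding n) := by
  refine isSymmetry_of_permutes_copies ⟨?_, ?_⟩ (Equiv.swap 0 2) (fun n i x hx => ?_) n
  · decide
  · rw [edges_zero]
    decide
  · have hx := fst_add_snd_le_of_mem_verts hx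
    rw [hatEmbedding_apply hx, hatEmbedding_apply (copy_fst_add_snd_le i hx), hat_copy i hx]

theorem F_tilde (j n : ℕ) (x : ℕ × ℕ) : F j n (tilde x) = F j n x := by
  rw [F_eq_proportion, F_eq_proportion]
  exact (isSymmetry_tildeEmbedding n).proportion_apply
    (fun G => (isCornerForest_swapAB_iff (p := .joined)).symm) j x

theorem G_tilde (j n : ℕ) (x : ℕ × ℕ) : G j n (tilde x) = proportion j n x .aIsolated := by
  rw [G_eq_proportion]
  exact (isSymmetry_tildeEmbedding n).proportion_apply
    (fun G => (isCornerForest_swapAB_iff (p := .bIsolated)).symm) j x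

theorem G_hat (j : ℕ) {x : ℕ × ℕ} (hx : x.1 + x.2 ≤ 2 ^ n) :
    G j n (hat n x) = proportion j n x .oIsolated := by
  have hat_o : hatEmbedding n o = b n := by simp [hatEmbedding, hat, o, b]
  have hat_a : hatEmbedding n (a n) = a n := by simp [hatEmbedding, hat, a]
  have hat_b : hatEmbedding n (b n) = o := by simp [hatEmbedding, hat, o, b]
  rw [G_eq_proportion, ← hatEmbedding_apply hx]
  refine (isSymmetry_hatEmbedding n).proportion_apply (fun G => ?_) j x
  rw [hat_o, hat_a, hat_b]
  exact (isCornerForest_swapOB_iff (p := .bIsolated)).symm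

theorem B_apply (j : ℕ) {v : Fin 3 → ℕ × ℕ} {i : Fin 3} (hv : (v i).1 + (v i).2 ≤ 2 ^ n) :
    B j n n v i = profile j n (v i) := by
  have B_row : B j n n v i =
    ![F j n (v i), G j n (v i), G j n (tilde (v i)), G j n (hat n (v i)), H j n (v i)] := rfl
  rw [B_row, F_eq_proportion, G_eq_proportion, G_tilde, G_hat j hv, H_eq_proportion]
  funext k
  fin_cases k <;> rfl

theorem vtxOne_succ (m : ℕ) (i : Fin 3) : vtxOne (m + 1) i = shiftA (m + 1) (vtx m i) := by
  fin_cases i <;> simp [vtxOne, vtx, a, b, c, add_comm]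

theorem vtx_lt (m : ℕ) (i : Fin 3) : (vtx m i).1 < 2 ^ (m + 1) ∧ (vtx m i).2 < 2 ^ (m + 1) := by
  fin_cases i <;> simp [vtx, a, b, c, Nat.pow_lt_pow_succ]

theorem vtx_fst_add_snd_le (m : ℕ) (i : Fin 3) : (vtx m i).1 + (vtx m i).2 ≤ 2 ^ (m + 1) := by
  fin_cases i <;> simp [vtx, a, b, c, pow_succ]; lia

theorem vtx_ne_o (m : ℕ) (i : Fin 3) : vtx m i ≠ o := by
  fin_cases i <;> simp [vtx, a, b, c, o]

theorem mul_mul_pow_mulVec_e₁ (M : Matrix (Fin 3) (Fin 5) ℚ) (m : ℕ) (i : Fin 3) :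
    Matrix.mulVec (M * R * L ^ m) e₁ i =
      Matrix.vecMul (Matrix.vecMul (M i) R) (L ^ m) 0 := by
  have e₁_eq : e₁ = Pi.single 0 1 := by ext k; fin_cases k <;> rfl
  rw [e₁_eq, Matrix.mulVec_single_one, Matrix.col_apply, Matrix.mul_apply_eq_vecMul,
    Matrix.mul_apply_eq_vecMul]

theorem F_vtxOne_eq_mulVec (j k m : ℕ) (i : Fin 3) :
    F j (k + 2 + m) (vtxOne (k + 1) i) =
      Matrix.mulVec (B j (k + 1) (k + 1) (vtx k) * R * L ^ m) e₁ i := by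
  obtain ⟨lt₁, lt₂⟩ := vtx_lt k i
  have lt₁' : (vtxOne (k + 1) i).1 < 2 ^ (k + 2) := by
    rw [vtxOne_succ, pow_succ]
    simp only [addRightEmbedding_apply, a, Prod.fst_add]
    lia
  have lt₂' : (vtxOne (k + 1) i).2 < 2 ^ (k + 2) := by
    rw [vtxOne_succ, pow_succ]
    simp only [addRightEmbedding_apply, a, Prod.snd_add, add_zero]
    lia
  calc F j (k + 2 + m) (vtxOne (k + 1) i)
      = profile j (k + 2 + m) (vtxOne (k + 1) i) 0 := F_eq_proportion _ _ _
    _ = Matrix.vecMul (profile j (k + 2) (vtxOne (k + 1) i)) (L ^ m) 0 :=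
      profile_add_apply_of_lt j m lt₁' lt₂' (by decide)
    _ = Matrix.vecMul (Matrix.vecMul (profile j (k + 1) (vtx k i)) R) (L ^ m) 0 := by
      rw [vtxOne_succ, profile_succ_shiftA j (vtx_ne_o k i) lt₂]
    _ = Matrix.mulVec (B j (k + 1) (k + 1) (vtx k) * R * L ^ m) e₁ i := by
      rw [mul_mul_pow_mulVec_e₁, B_apply j (vtx_fst_add_snd_le k i)]

end Symmetry

end SG

theorem mainTheorem6 (n m j : ℕ) (hn : 2 ≤ n) (hj₁ : 1 ≤ j) (hj₄ : j ≤ 4) :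
    (fun i : Fin 3 => SG.F j (n + m) (SG.vtxOne (n - 1) i)) =
        (fun i : Fin 3 => SG.F j (n + m) (SG.tilde (SG.vtxOne (n - 1) i))) ∧
      (fun i : Fin 3 => SG.F j (n + m) (SG.vtxOne (n - 1) i)) =
        Matrix.mulVec (SG.B j (n - 1) (n - 1) (SG.vtx (n - 2)) * SG.R * SG.L ^ m) SG.e₁ := by
  refine ⟨funext fun i => (SG.F_tilde _ _ _).symm, funext fun i => ?_⟩
  obtain ⟨k, rfl⟩ := Nat.exists_eq_add_of_le' hn
  exact SG.F_vtxOne_eq_mulVec j k m i
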